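/- Let $n\ge 2$ and let $M$ be a connected smooth $n$-dimensional manifold (without boundary), immersed as a hypersurface in Euclidean space $\mathbb{E}^{n+1}$ by a smooth immersion $f:M\to\mathbb{E}^{n+1}$, with induced metric $g$. Let $V$ be the position vector field of $\mathbb{E}^{n+1}$, so that $V=f(x)$ at the point $x\in M$, and let $V^T$ be its tangential part: $V^T(x)\in T_xM$ is the vector for which $df_x(V^T(x))$ is the orthogonal projection of $f(x)$ onto $df_x(T_xM)$. Suppose that $(M,g,V^T,\varphi)$ is a conformal soliton, i.e. $\varphi:M\to\mathbb{R}$ is a smooth function with $$\varphi\, g=\tfrac12\,\mathcal{L}_{V^T}g,\qquad (\mathcal{L}_Xg)(Y,Z)=X(g(Y,Z))-g([X,Y],Z)-g(Y,[X,Z])$$ (completeness of $V^T$ is not needed). Then at least one of the following holds: 1. $f(M)$ is contained in an affine hyperplane of $\mathbb{E}^{n+1}$; 2. $M$ is a conic hypersurface: every point of $M$ has an open neighbourhood $U$ such that $f(U)$ is an open portion of a cone with vertex at the origin, i.e. a relatively open subset of $\{t y: t\ge 0,\ y\in S\}$ for some smooth embedded hypersurface $S$ of the unit sphere $\mathbb{S}^n$;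 3. $f(M)$ is contained in a hypersphere of $\mathbb{E}^{n+1}$ (of some centre and some radius $r>0$). -/

import Mathlib

open scoped Manifold ContDiff

noncomputable section

namespace ConformalSoliton

/-! ### Vector fields, Lie derivative of a metric, conformal solitons

In this part `M` is a smooth `n`-dimensional manifold without boundary. -/

section Intrinsic

variable {n : ℕ} {M : Type*} [TopologicalSpace M] [ChartedSpace (EuclideanSpace ℝ (Fin n)) M]

/-- A (rough) vector field `X` on `M` is smooth if it is smooth as a section of the tangent
bundle. -/
def IsSmoothVectorField [IsManifold (𝓡 n) ∞ M] (X : (x : M) → TangentSpace (𝓡 n) x) : Prop :=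
  ContMDiff (𝓡 n) (𝓡 n).tangent ∞ (fun x : M => (⟨x, X x⟩ : TangentBundle (𝓡 n) M))

/-- The Lie derivative of a field `g` of bilinear forms on the tangent spaces of `M`,
`(L_X g)(Y, Z) = X(g(Y, Z)) - g([X, Y], Z) - g(Y, [X, Z])`, evaluated at the point `x`. -/
def lieDerivative (g : (x : M) → TangentSpace (𝓡 n) x → TangentSpace (𝓡 n) x → ℝ)
    (X Y Z : (x : M) → TangentSpace (𝓡 n) x) (x : M) : ℝ :=
  mvfderiv (𝓡 n) (fun y : M => g y (Y y) (Z y)) x (X x)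
    - g x (VectorField.mlieBracket (𝓡 n) X Y x) (Z x)
    - g x (Y x) (VectorField.mlieBracket (𝓡 n) X Z x)

/-- `(M, g, v, φ)` satisfies the conformal soliton equation `φ g = (1/2) L_v g`, where `v` is a
smooth vector field and `φ` a smooth function on `M`. (Completeness of `v` is not required.) -/
structure IsConformalSoliton [IsManifold (𝓡 n) ∞ M]
    (g : (x : M) → TangentSpace (𝓡 n) x → TangentSpace (𝓡 n) x → ℝ)
    (v : (x : M) → TangentSpace (𝓡 n) x) (φ : M → ℝ) : Prop where
  smooth_vectorField : IsSmoothVectorField v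
  smooth_function : ContMDiff (𝓡 n) 𝓘(ℝ, ℝ) ∞ φ
  equation : ∀ Y Z : (x : M) → TangentSpace (𝓡 n) x,
    IsSmoothVectorField Y → IsSmoothVectorField Z →
      ∀ x : M, φ x * g x (Y x) (Z x) = (1 / 2) * lieDerivative g v Y Z x

end Intrinsic

/-! ### Hypersurfaces of Euclidean space

A hypersurface is given by a smooth map `f : M → 𝔼ⁿ⁺¹` with injective differentials. -/

section Hypersurface

variable {n : ℕ} {M : Type*} [TopologicalSpace M] [ChartedSpace (EuclideanSpace ℝ (Fin n)) M]

/-- The differential of `f` at `x`, as a linear map into `𝔼ⁿ⁺¹`. -/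
abbrev differential (f : M → EuclideanSpace ℝ (Fin (n + 1))) (x : M) :
    TangentSpace (𝓡 n) x →L[ℝ] EuclideanSpace ℝ (Fin (n + 1)) :=
  mvfderiv (𝓡 n) f x

/-- `f` is a smooth immersion of the `n`-manifold `M` into `𝔼ⁿ⁺¹`, i.e. it makes `M` an
(immersed) hypersurface. -/
structure IsHypersurface (f : M → EuclideanSpace ℝ (Fin (n + 1))) : Prop where
  smooth : ContMDiff (𝓡 n) 𝓘(ℝ, EuclideanSpace ℝ (Fin (n + 1))) ∞ f
  injective_differential : ∀ x : M, Function.Injective (differential f x)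

/-- The metric on `M` induced by `f` from the Euclidean metric. -/
def inducedMetric (f : M → EuclideanSpace ℝ (Fin (n + 1))) (x : M)
    (u w : TangentSpace (𝓡 n) x) : ℝ :=
  inner ℝ (differential f x u) (differential f x w)

/-- The image of the tangent space at `x` under the differential of `f`. -/
def tangentImage (f : M → EuclideanSpace ℝ (Fin (n + 1))) (x : M) :
    Submodule ℝ (EuclideanSpace ℝ (Fin (n + 1))) :=
  LinearMap.range (differential f x).toLinearMap

theorem exists_tangential_part (f : M → EuclideanSpace ℝ (Fin (n + 1))) (x : M) :
    ∃ u : TangentSpace (𝓡 n) x, differential f x u = (tangentImage f x).starProjection (f x) :=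
  LinearMap.mem_range.mp ((tangentImage f x).starProjection_apply_mem (f x))

/-- The tangential part `V^T` of the position vector field `V` along `f`: at `x` it is the tangent
vector whose image under the differential of `f` is the orthogonal projection of the position
vector `f x` onto the tangent space (it is unique when the differential is injective). -/
def positionTangent (f : M → EuclideanSpace ℝ (Fin (n + 1))) (x : M) : TangentSpace (𝓡 n) x :=
  (exists_tangential_part f x).choose

theorem differential_positionTangent (f : M → EuclideanSpace ℝ (Fin (n + 1))) (x : M) :
    differential f x (positionTangent f x) = (tangentImage f x).starProjection (f x) :=
  (exists_tangential_part f x).choose_spec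

end Hypersurface

/-! ### Conic hypersurfaces -/

section Conic

/-- `S` is a smooth embedded hypersurface of the unit sphere of `𝔼ⁿ⁺¹` (not necessarily closed):
near each of its points it is the zero set in the sphere of a smooth function whose
differential does not vanish on the tangent space of the sphere. -/
def IsSphericalHypersurface {n : ℕ} (S : Set (EuclideanSpace ℝ (Fin (n + 1)))) : Prop :=
  S ⊆ Metric.sphere 0 1 ∧
    ∀ y ∈ S, ∃ (W : Set (EuclideanSpace ℝ (Fin (n + 1))))
      (F : EuclideanSpace ℝ (Fin (n + 1)) → ℝ),
      IsOpen W ∧ y ∈ W ∧ ContDiffOn ℝ ∞ F W ∧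
        S ∩ W = {z | z ∈ Metric.sphere 0 1 ∧ z ∈ W ∧ F z = 0} ∧
        ∃ w, inner ℝ y w = 0 ∧ fderiv ℝ F y w ≠ 0

/-- The cone with vertex at the origin over `S`, vertex included. -/
def cone {n : ℕ} (S : Set (EuclideanSpace ℝ (Fin (n + 1)))) :
    Set (EuclideanSpace ℝ (Fin (n + 1))) :=
  {p | ∃ t : ℝ, 0 ≤ t ∧ ∃ y ∈ S, p = t • y}

/-- The hypersurface `f` is conic: around each point of `M` it is an open portion of a cone with
vertex at the origin over a smooth hypersurface of the unit sphere. -/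
def IsConic {n : ℕ} {M : Type*} [TopologicalSpace M]
    (f : M → EuclideanSpace ℝ (Fin (n + 1))) : Prop :=
  ∀ x : M, ∃ (U : Set M) (S O : Set (EuclideanSpace ℝ (Fin (n + 1)))),
    IsOpen U ∧ x ∈ U ∧ IsSphericalHypersurface S ∧ IsOpen O ∧ f '' U = O ∩ cone S

end Conic

end ConformalSoliton

end

noncomputable section

namespace ConformalSoliton

/-! Write `f = ξ + df(V^T)` with `ξ` normal. Expanding the Lie derivative through the commutator
formula for brackets turns the soliton equation into `⟨dξ(u), df(w)⟩ = (1 - φ) ⟨df(u), df(w)⟩`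
(`IsConformalSoliton.inner_mvfderiv_normalPart`). Locally `ξ = h N`, with `N` a unit normal and `h =
⟨f, N⟩` the support function, so the equation reads `h dN = (1 - φ) df`: the hypersurface is
umbilical wherever `h ≠ 0`.

Suppose `dN` is injective at some point. Nearby, `h` cannot vanish on an open set, so umbilicity
extends by continuity. As `n ≥ 2`, the principal curvature is a nonzero constant and a neighbourhood
lies in a sphere. The set of points near which `f` stays in that sphere is open, and it is closed
because the second fundamental form of a sphere remains nondegenerate in the limit. By connectedness
it is all of `M`.

Otherwise `dN` is nowhere injective, which forces `h dN = 0` everywhere. Then `d(h²) = 2h⟨f, dN⟩ =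
0`, so `|ξ|` is constant. If it is nonzero, then `dN = 0`, `ξ` is a constant vector and `⟨ξ, f⟩ =
|ξ|²` is a hyperplane. If it is zero, the position vector is tangent everywhere.

In that last case, parametrize `M` near `x₀` by a graph `γ` over the tangent space at `x₀`. Tangency
becomes Euler's relation `dγ_y(y) = γ(y)`, so `γ` is homogeneous of degree one along rays. Away from
the origin its image is an open piece of a cone; at the origin, homogeneity and differentiability
make `γ` linear, and the cone is a hyperplane. -/

theorem fderiv_lieBracket {V E : Type*} [NormedAddCommGroup V] [NormedSpace ℝ V]
    [NormedAddCommGroup E] [NormedSpace ℝ E] {F : V → E} {y : V} (hF : ContDiffAt ℝ 2 F y)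
    {X Y : V → V} (hX : DifferentiableAt ℝ X y) (hY : DifferentiableAt ℝ Y y) :
    fderiv ℝ F y (VectorField.lieBracket ℝ X Y y) =
      fderiv ℝ (fun z => fderiv ℝ F z (Y z)) y (X y) -
        fderiv ℝ (fun z => fderiv ℝ F z (X z)) y (Y y) := by
  have hD : DifferentiableAt ℝ (fderiv ℝ F) y :=
    (hF.fderiv_right (m := 1) (by norm_num)).differentiableAt one_ne_zero
  have hsymm : IsSymmSndFDerivAt ℝ F y := hF.isSymmSndFDerivAt (by simp)
  rw [fderiv_clm_apply hD hY, fderiv_clm_apply hD hX, VectorField.lieBracket_eq]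
  simp only [map_sub, add_apply, ContinuousLinearMap.comp_apply, ContinuousLinearMap.flip_apply]
  rw [hsymm.eq (X y) (Y y)]
  abel

/-! ### Lie brackets as commutators of derivations -/

section Bracket

variable {n : ℕ} {M : Type*} [TopologicalSpace M] [ChartedSpace (EuclideanSpace ℝ (Fin n)) M]
  {E : Type*} [NormedAddCommGroup E] [NormedSpace ℝ E]

/-- A vector field read in the preferred chart at `x`. -/
def chartField (x : M) (X : (z : M) → TangentSpace (𝓡 n) z) :
    EuclideanSpace ℝ (Fin n) → EuclideanSpace ℝ (Fin n) :=
  VectorField.mpullbackWithin 𝓘(ℝ, EuclideanSpace ℝ (Fin n)) (𝓡 n)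
    (extChartAt (𝓡 n) x).symm X (Set.range (𝓡 n))

theorem mvfderiv_extChartAt_symm [IsManifold (𝓡 n) 1 M] (x : M) {y : EuclideanSpace ℝ (Fin n)}
    (hy : y ∈ (extChartAt (𝓡 n) x).target) {k : M → E}
    (hk : MDifferentiableAt (𝓡 n) 𝓘(ℝ, E) k ((extChartAt (𝓡 n) x).symm y))
    (X : (z : M) → TangentSpace (𝓡 n) z) :
    mvfderiv (𝓡 n) k ((extChartAt (𝓡 n) x).symm y) (X ((extChartAt (𝓡 n) x).symm y)) =
      fderiv ℝ (k ∘ (extChartAt (𝓡 n) x).symm) y (chartField x X y) := by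
  have hinv := isInvertible_mfderivWithin_extChartAt_symm (I := 𝓡 n) hy
  have hd : MDifferentiableAt 𝓘(ℝ, EuclideanSpace ℝ (Fin n)) (𝓡 n)
      (extChartAt (𝓡 n) x).symm y := by
    have := mdifferentiableWithinAt_extChartAt_symm (I := 𝓡 n) hy
    rw [ModelWithCorners.range_eq_univ] at this
    exact mdifferentiableWithinAt_univ.1 this
  have hc : mfderiv 𝓘(ℝ, EuclideanSpace ℝ (Fin n)) 𝓘(ℝ, E) (k ∘ (extChartAt (𝓡 n) x).symm) y =
      _ := mfderiv_comp y hk hd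
  rw [mfderiv_eq_fderiv] at hc
  rw [hc, chartField, VectorField.mpullbackWithin_apply]
  have hr : Set.range (𝓡 n) = Set.univ := by simp
  rw [hr] at hinv ⊢
  rw [mfderivWithin_univ] at hinv ⊢
  have := hinv.self_comp_inverse
  have h2 := congrArg (fun A => A (X ((extChartAt (𝓡 n) x).symm y))) this
  change _ = (mfderiv (𝓡 n) 𝓘(ℝ, E) k ((extChartAt (𝓡 n) x).symm y))
    ((mfderiv 𝓘(ℝ, EuclideanSpace ℝ (Fin n)) (𝓡 n) (extChartAt (𝓡 n) x).symm y) _)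
  erw [h2]
  rfl

/-- The manifold bracket at `x` is the Euclidean bracket in the chart, carried back by the inverse
of the derivative of the chart; this is the chain rule for vectors of that form. -/
theorem mvfderiv_inverse_mfderiv_extChartAt [IsManifold (𝓡 n) 1 M] (x : M) {k : M → E}
    (hk : MDifferentiableAt (𝓡 n) 𝓘(ℝ, E) k x) (w : EuclideanSpace ℝ (Fin n)) :
    mvfderiv (𝓡 n) k x ((mfderiv (𝓡 n) 𝓘(ℝ, EuclideanSpace ℝ (Fin n))
      (extChartAt (𝓡 n) x) x).inverse w) =
      fderiv ℝ (k ∘ (extChartAt (𝓡 n) x).symm) (extChartAt (𝓡 n) x x) w := by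
  have hinv := isInvertible_mfderiv_extChartAt (I := 𝓡 n) (mem_extChartAt_source x (I := 𝓡 n))
  have hex : (extChartAt (𝓡 n) x).symm (extChartAt (𝓡 n) x x) = x := extChartAt_to_inv x
  have he : MDifferentiableAt (𝓡 n) 𝓘(ℝ, EuclideanSpace ℝ (Fin n)) (extChartAt (𝓡 n) x) x :=
    mdifferentiableAt_extChartAt (mem_chart_source _ x)
  have hs : MDifferentiableAt 𝓘(ℝ, EuclideanSpace ℝ (Fin n)) (𝓡 n)
      (extChartAt (𝓡 n) x).symm (extChartAt (𝓡 n) x x) := by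
    have := mdifferentiableWithinAt_extChartAt_symm (I := 𝓡 n) (mem_extChartAt_target x)
    rw [ModelWithCorners.range_eq_univ] at this
    exact mdifferentiableWithinAt_univ.1 this
  have hks : MDifferentiableAt 𝓘(ℝ, EuclideanSpace ℝ (Fin n)) 𝓘(ℝ, E)
      (k ∘ (extChartAt (𝓡 n) x).symm) (extChartAt (𝓡 n) x x) :=
    MDifferentiableAt.comp _ (by rwa [hex]) hs
  have heq : (k ∘ (extChartAt (𝓡 n) x).symm) ∘ (extChartAt (𝓡 n) x) =ᶠ[nhds x] k := by
    filter_upwards [extChartAt_source_mem_nhds (I := 𝓡 n) x] with z hz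
    simp only [Function.comp_apply]
    rw [(extChartAt (𝓡 n) x).left_inv hz]
  have hc := mfderiv_comp x hks he
  rw [heq.mfderiv_eq, mfderiv_eq_fderiv] at hc
  have h2 := congrArg (fun A => A w) hinv.self_comp_inverse
  change (mfderiv (𝓡 n) 𝓘(ℝ, E) k x) _ = _
  rw [hc]
  exact congrArg (fderiv ℝ (k ∘ (extChartAt (𝓡 n) x).symm) (extChartAt (𝓡 n) x x)) h2

theorem contMDiff_mvfderiv_apply [IsManifold (𝓡 n) ∞ M] {f : M → E}
    (hf : ContMDiff (𝓡 n) 𝓘(ℝ, E) ∞ f) {X : (z : M) → TangentSpace (𝓡 n) z}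
    (hX : IsSmoothVectorField X) :
    ContMDiff (𝓡 n) 𝓘(ℝ, E) ∞ (fun y => mvfderiv (𝓡 n) f y (X y)) := by
  have h1 : ContMDiff (𝓡 n).tangent 𝓘(ℝ, E).tangent ∞ (tangentMap (𝓡 n) 𝓘(ℝ, E) f) :=
    hf.contMDiff_tangentMap le_rfl
  have h2 := h1.comp hX
  exact (contMDiff_snd_tangentBundle_modelSpace E 𝓘(ℝ, E)).comp h2

theorem differentiableAt_chartField [IsManifold (𝓡 n) ∞ M] (x : M)
    {X : (z : M) → TangentSpace (𝓡 n) z} (hX : IsSmoothVectorField X) :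
    DifferentiableAt ℝ (chartField x X) (extChartAt (𝓡 n) x x) := by
  have h1 := MDifferentiableWithinAt.differentiableWithinAt_mpullbackWithin_vectorField
    (I := 𝓡 n) (V := X) (s := Set.univ) (x := x)
    (((hX x).mdifferentiableAt (by simp)).mdifferentiableWithinAt)
  rw [Set.preimage_univ, ModelWithCorners.range_eq_univ, Set.univ_inter] at h1
  rw [chartField, ModelWithCorners.range_eq_univ]
  exact differentiableWithinAt_univ.1 h1

/-- Differentiating a function along a Lie bracket gives the commutator of the derivations. -/
theorem mvfderiv_mlieBracket [IsManifold (𝓡 n) ∞ M] {f : M → E}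
    (hf : ContMDiff (𝓡 n) 𝓘(ℝ, E) ∞ f) {X Y : (z : M) → TangentSpace (𝓡 n) z}
    (hX : IsSmoothVectorField X) (hY : IsSmoothVectorField Y) (x : M) :
    mvfderiv (𝓡 n) f x (VectorField.mlieBracket (𝓡 n) X Y x) =
      mvfderiv (𝓡 n) (fun y => mvfderiv (𝓡 n) f y (Y y)) x (X x) -
        mvfderiv (𝓡 n) (fun y => mvfderiv (𝓡 n) f y (X y)) x (Y x) := by
  set e := extChartAt (𝓡 n) x with he
  have hxt : e x ∈ e.target := mem_extChartAt_target x
  have hex : e.symm (e x) = x := extChartAt_to_inv x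
  have htn : e.target ∈ nhds (e x) := extChartAt_target_mem_nhds x
  have hFs : ContDiffOn ℝ ∞ (f ∘ e.symm) e.target :=
    (hf.comp_contMDiffOn (contMDiffOn_extChartAt_symm (I := 𝓡 n) (n := ∞) x)).contDiffOn
  have key : ∀ (k : M → E), ContMDiff (𝓡 n) 𝓘(ℝ, E) ∞ k →
      ∀ Z : (z : M) → TangentSpace (𝓡 n) z, ∀ y ∈ e.target,
      mvfderiv (𝓡 n) k (e.symm y) (Z (e.symm y)) =
        fderiv ℝ (k ∘ e.symm) y (chartField x Z y) := fun k hk Z y hy =>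
    mvfderiv_extChartAt_symm x hy ((hk _).mdifferentiableAt (by simp)) Z
  have key2 : ∀ Z W : (z : M) → TangentSpace (𝓡 n) z, IsSmoothVectorField W →
      mvfderiv (𝓡 n) (fun y => mvfderiv (𝓡 n) f y (W y)) x (Z x) =
      fderiv ℝ (fun y => fderiv ℝ (f ∘ e.symm) y (chartField x W y)) (e x)
        (chartField x Z (e x)) := by
    intro Z W hW
    have h1 := key _ (contMDiff_mvfderiv_apply hf hW) Z (e x) hxt
    rw [hex] at h1
    rw [h1]
    have h2 : ((fun y => mvfderiv (𝓡 n) f y (W y)) ∘ e.symm) =ᶠ[nhds (e x)]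
        (fun y => fderiv ℝ (f ∘ e.symm) y (chartField x W y)) := by
      filter_upwards [htn] with y hy
      exact key f hf W y hy
    rw [h2.fderiv_eq]
  rw [key2 X Y hY, key2 Y X hX, ← fderiv_lieBracket
    ((hFs.contDiffAt htn).of_le (by norm_cast)) (differentiableAt_chartField x hX)
    (differentiableAt_chartField x hY), ← mvfderiv_inverse_mfderiv_extChartAt x
      ((hf _).mdifferentiableAt (by simp)), ← VectorField.mlieBracketWithin_univ,
      VectorField.mlieBracketWithin_apply, ← VectorField.lieBracketWithin_univ]
  congr 3
  simp
  rfl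

/-- Every tangent vector is the value of a global smooth vector field. -/
theorem exists_smoothVectorField [IsManifold (𝓡 n) ∞ M] [T2Space M] (x : M)
    (v : TangentSpace (𝓡 n) x) :
    ∃ X : (z : M) → TangentSpace (𝓡 n) z, IsSmoothVectorField X ∧ X x = v := by
  obtain ⟨s, hs, hsm⟩ := FiberBundle.exists_contMDiffOn_extend (k := ∞) (𝓡 n)
    (EuclideanSpace ℝ (Fin n)) (V := (TangentSpace (𝓡 n) : M → Type _)) v
  obtain ⟨b, -, hb⟩ := (SmoothBumpFunction.nhds_basis_tsupport (I := 𝓡 n) x).mem_iff.1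
    (interior_mem_nhds.2 hs)
  refine ⟨(b : M → ℝ) • FiberBundle.extend (EuclideanSpace ℝ (Fin n)) v, ?_, ?_⟩
  · exact ContMDiffOn.smul_section_of_tsupport b.contMDiff.contMDiffOn isOpen_interior hb
      (hsm.mono interior_subset)
  · simp

end Bracket

/-! ### The soliton equation and the normal part of the position vector -/

section NormalPart

variable {n : ℕ} {M : Type*} [TopologicalSpace M] [ChartedSpace (EuclideanSpace ℝ (Fin n)) M]

theorem mvfderiv_inner {E : Type*} [NormedAddCommGroup E] [InnerProductSpace ℝ E] {a b : M → E}
    {x : M} (ha : MDifferentiableAt (𝓡 n) 𝓘(ℝ, E) a x)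
    (hb : MDifferentiableAt (𝓡 n) 𝓘(ℝ, E) b x) (v : TangentSpace (𝓡 n) x) :
    mvfderiv (𝓡 n) (fun y => inner ℝ (a y) (b y)) x v =
      inner ℝ (a x) (mvfderiv (𝓡 n) b x v) + inner ℝ (mvfderiv (𝓡 n) a x v) (b x) := by
  have h := (ha.hasMFDerivAt.2.inner ℝ hb.hasMFDerivAt.2)
  have hc : ContinuousAt (fun y => inner ℝ (a y) (b y)) x :=
    ha.continuousAt.inner hb.continuousAt
  have hm : HasMFDerivAt (𝓡 n) 𝓘(ℝ, ℝ) (fun y => inner ℝ (a y) (b y)) x _ := ⟨hc, h⟩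
  change mfderiv (𝓡 n) 𝓘(ℝ, ℝ) (fun y => inner ℝ (a y) (b y)) x v = _
  rw [hm.mfderiv]
  change inner ℝ ((a ∘ (extChartAt (𝓡 n) x).symm) (extChartAt (𝓡 n) x x)) _ +
    inner ℝ _ ((b ∘ (extChartAt (𝓡 n) x).symm) (extChartAt (𝓡 n) x x)) = _
  simp only [Function.comp_apply]
  rw [extChartAt_to_inv x]
  rfl

/-- The component of the position vector orthogonal to the hypersurface. -/
def normalPart (f : M → EuclideanSpace ℝ (Fin (n + 1))) (x : M) : EuclideanSpace ℝ (Fin (n + 1)) :=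
  f x - differential f x (positionTangent f x)

theorem differential_mem_tangentImage (f : M → EuclideanSpace ℝ (Fin (n + 1))) (x : M)
    (v : TangentSpace (𝓡 n) x) : differential f x v ∈ tangentImage f x := ⟨v, rfl⟩

theorem normalPart_mem (f : M → EuclideanSpace ℝ (Fin (n + 1))) (x : M) :
    normalPart f x ∈ (tangentImage f x)ᗮ := by
  rw [normalPart, differential_positionTangent]
  exact Submodule.sub_starProjection_mem_orthogonal _

theorem inner_normalPart_differential (f : M → EuclideanSpace ℝ (Fin (n + 1))) (x : M)
    (v : TangentSpace (𝓡 n) x) : inner ℝ (normalPart f x) (differential f x v) = 0 :=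
  Submodule.inner_left_of_mem_orthogonal (differential_mem_tangentImage f x v) (normalPart_mem f x)

theorem contMDiff_normalPart [IsManifold (𝓡 n) ∞ M] {f : M → EuclideanSpace ℝ (Fin (n + 1))}
    (hf : IsHypersurface f) (hv : IsSmoothVectorField (positionTangent f)) :
    ContMDiff (𝓡 n) 𝓘(ℝ, EuclideanSpace ℝ (Fin (n + 1))) ∞ (normalPart f) :=
  hf.smooth.sub (contMDiff_mvfderiv_apply hf.smooth hv)

/-- The soliton equation in terms of the derivative of the normal part of the position vector. -/
theorem IsConformalSoliton.inner_mvfderiv_normalPart [IsManifold (𝓡 n) ∞ M] [T2Space M]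
    {f : M → EuclideanSpace ℝ (Fin (n + 1))} (hf : IsHypersurface f) {φ : M → ℝ}
    (hsol : IsConformalSoliton (inducedMetric f) (positionTangent f) φ) (x : M)
    (u w : TangentSpace (𝓡 n) x) :
    inner ℝ (mvfderiv (𝓡 n) (normalPart f) x u) (differential f x w) =
      (1 - φ x) * inner ℝ (differential f x u) (differential f x w) := by
  obtain ⟨Y, hY, rfl⟩ := exists_smoothVectorField x u
  obtain ⟨Z, hZ, rfl⟩ := exists_smoothVectorField x w
  have hX := hsol.smooth_vectorField
  have heq := hsol.equation Y Z hY hZ x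
  have hfs := hf.smooth
  have hN := contMDiff_normalPart hf hX
  have md : ∀ {k : M → EuclideanSpace ℝ (Fin (n + 1))},
      ContMDiff (𝓡 n) 𝓘(ℝ, EuclideanSpace ℝ (Fin (n + 1))) ∞ k →
      MDifferentiableAt (𝓡 n) 𝓘(ℝ, EuclideanSpace ℝ (Fin (n + 1))) k x :=
    fun hk => (hk x).mdifferentiableAt (by simp)
  have dY := contMDiff_mvfderiv_apply hfs hY
  have dZ := contMDiff_mvfderiv_apply hfs hZ
  have dX := contMDiff_mvfderiv_apply hfs hX
  have bXY := mvfderiv_mlieBracket hfs hX hY x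
  have bXZ := mvfderiv_mlieBracket hfs hX hZ x
  have bYZ := mvfderiv_mlieBracket hfs hY hZ x
  have hXf : ∀ V : (z : M) → TangentSpace (𝓡 n) z,
      mvfderiv (𝓡 n) (fun y => mvfderiv (𝓡 n) f y (positionTangent f y)) x (V x) =
        mvfderiv (𝓡 n) f x (V x) - mvfderiv (𝓡 n) (normalPart f) x (V x) := by
    intro V
    have h1 : mvfderiv (𝓡 n) (normalPart f) x = _ := mvfderiv_fun_sub (md hfs) (md dX)
    rw [h1]
    simp
  have hperp : ∀ V W : (z : M) → TangentSpace (𝓡 n) z, IsSmoothVectorField W →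
      inner ℝ (normalPart f x) (mvfderiv (𝓡 n) (fun y => mvfderiv (𝓡 n) f y (W y)) x (V x)) +
        inner ℝ (mvfderiv (𝓡 n) (normalPart f) x (V x)) (mvfderiv (𝓡 n) f x (W x)) = 0 := by
    intro V W hW
    rw [← mvfderiv_inner (md hN) (md (contMDiff_mvfderiv_apply hfs hW))]
    have : (fun y => inner ℝ (normalPart f y) (mvfderiv (𝓡 n) f y (W y))) = fun _ => (0 : ℝ) := by
      funext y
      exact inner_normalPart_differential f y (W y)
    rw [this, mvfderiv_const]
    simp
  have h1 := hperp Y Z hZ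
  have h2 := hperp Z Y hY
  -- The Lie derivative only controls the symmetrization of `⟨dξ(Y), df(Z)⟩`. Since `[Y, Z]` is
  -- tangent, `⟨ξ, Y(Z f)⟩` is symmetric in `Y` and `Z`, hence so is `⟨dξ(Y), df(Z)⟩`, and nothing
  -- is lost.
  have h3 := inner_normalPart_differential f x (VectorField.mlieBracket (𝓡 n) Y Z x)
  rw [differential, bYZ, inner_sub_right] at h3
  simp only [lieDerivative, inducedMetric, differential] at heq
  rw [mvfderiv_inner (md dY) (md dZ), bXY, bXZ, hXf, hXf] at heq
  simp only [inner_sub_left, inner_sub_right] at heq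
  simp only [differential]
  have c1 := real_inner_comm (mvfderiv (𝓡 n) (normalPart f) x (Z x)) (mvfderiv (𝓡 n) f x (Y x))
  have c2 := real_inner_comm (mvfderiv (𝓡 n) (normalPart f) x (Y x)) (mvfderiv (𝓡 n) f x (Z x))
  linarith

end NormalPart

/-- Passes the identities characterizing a sphere to a limit point, in the closedness half of the
connectedness argument. -/
theorem eq_of_frequently_eq {X Y : Type*} [TopologicalSpace X] [TopologicalSpace Y] [T2Space Y]
    {a b : X → Y} {x : X} (ha : ContinuousAt a x) (hb : ContinuousAt b x)
    (hab : ∃ᶠ y in nhds x, a y = b y) : a x = b x := by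
  by_contra hne
  exact hab ((ha.prodMk hb).eventually
    ((isOpen_ne_fun continuous_fst continuous_snd).mem_nhds hne))

/-! ### Local theory: umbilical patches, spheres and degenerate patches -/

section LocalGeometry

variable {T E : Type*} [NormedAddCommGroup T] [NormedSpace ℝ T]
  [NormedAddCommGroup E] [InnerProductSpace ℝ E]

/-- A local parametrization `γ` of a hypersurface together with a smooth unit normal field `N`. -/
structure IsOrientedPatch (γ N : T → E) (Ω : Set T) : Prop where
  isOpen : IsOpen Ω
  smooth_map : ContDiffOn ℝ ∞ γ Ω
  smooth_normal : ContDiffOn ℝ ∞ N Ω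
  norm_normal : ∀ y ∈ Ω, ‖N y‖ = 1
  injective : ∀ y ∈ Ω, Function.Injective (fderiv ℝ γ y)
  orthogonal_iff : ∀ y ∈ Ω, ∀ w, inner ℝ (N y) w = 0 ↔ ∃ v, fderiv ℝ γ y v = w

namespace IsOrientedPatch

variable {γ N : T → E} {Ω : Set T}

theorem mono (h : IsOrientedPatch γ N Ω) {Ω' : Set T} (ho : IsOpen Ω') (hs : Ω' ⊆ Ω) :
    IsOrientedPatch γ N Ω' :=
  ⟨ho, h.smooth_map.mono hs, h.smooth_normal.mono hs, fun y hy => h.norm_normal y (hs hy),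
    fun y hy => h.injective y (hs hy), fun y hy => h.orthogonal_iff y (hs hy)⟩

theorem contDiffAt_map (h : IsOrientedPatch γ N Ω) {y : T} (hy : y ∈ Ω) : ContDiffAt ℝ ∞ γ y :=
  h.smooth_map.contDiffAt (h.isOpen.mem_nhds hy)

theorem contDiffAt_normal (h : IsOrientedPatch γ N Ω) {y : T} (hy : y ∈ Ω) : ContDiffAt ℝ ∞ N y :=
  h.smooth_normal.contDiffAt (h.isOpen.mem_nhds hy)

theorem differentiableAt_map (h : IsOrientedPatch γ N Ω) {y : T} (hy : y ∈ Ω) :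
    DifferentiableAt ℝ γ y := (h.contDiffAt_map hy).differentiableAt (by simp)

theorem differentiableAt_normal (h : IsOrientedPatch γ N Ω) {y : T} (hy : y ∈ Ω) :
    DifferentiableAt ℝ N y := (h.contDiffAt_normal hy).differentiableAt (by simp)

theorem contDiffAt_fderiv_map (h : IsOrientedPatch γ N Ω) {y : T} (hy : y ∈ Ω) :
    ContDiffAt ℝ ∞ (fderiv ℝ γ) y := (h.contDiffAt_map hy).fderiv_right (by simp)

theorem contDiffAt_fderiv_normal (h : IsOrientedPatch γ N Ω) {y : T} (hy : y ∈ Ω) :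
    ContDiffAt ℝ ∞ (fderiv ℝ N) y := (h.contDiffAt_normal hy).fderiv_right (by simp)

theorem inner_self (h : IsOrientedPatch γ N Ω) {y : T} (hy : y ∈ Ω) :
    inner ℝ (N y) (N y) = (1 : ℝ) := by
  rw [real_inner_self_eq_norm_sq, h.norm_normal y hy, one_pow]

theorem inner_fderiv_map (h : IsOrientedPatch γ N Ω) {y : T} (hy : y ∈ Ω) (v : T) :
    inner ℝ (N y) (fderiv ℝ γ y v) = 0 := (h.orthogonal_iff y hy _).2 ⟨v, rfl⟩

theorem inner_fderiv_normal (h : IsOrientedPatch γ N Ω) {y : T} (hy : y ∈ Ω) (v : T) :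
    inner ℝ (N y) (fderiv ℝ N y v) = 0 := by
  have h1 : (fun z => inner ℝ (N z) (N z)) =ᶠ[nhds y] fun _ => (1 : ℝ) := by
    filter_upwards [h.isOpen.mem_nhds hy] with z hz
    exact h.inner_self hz
  have h2 := h1.fderiv_eq (𝕜 := ℝ)
  have h3 := fderiv_inner_apply ℝ (h.differentiableAt_normal hy) (h.differentiableAt_normal hy) v
  rw [h2, real_inner_comm (N y) (fderiv ℝ N y v)] at h3
  simp only [fderiv_fun_const, Pi.zero_apply, zero_apply] at h3
  linarith

/-- The derivative of the support function. -/
theorem fderiv_support (h : IsOrientedPatch γ N Ω) {y : T} (hy : y ∈ Ω) (c : E) (v : T) :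
    fderiv ℝ (fun z => inner ℝ (γ z - c) (N z)) y v = inner ℝ (γ y - c) (fderiv ℝ N y v) := by
  rw [fderiv_inner_apply ℝ ((h.differentiableAt_map hy).sub_const c) (h.differentiableAt_normal hy),
    fderiv_sub_const, real_inner_comm (N y) (fderiv ℝ γ y v), h.inner_fderiv_map hy v,
    add_zero]

theorem differentiableAt_support (h : IsOrientedPatch γ N Ω) {y : T} (hy : y ∈ Ω) (c : E) :
    DifferentiableAt ℝ (fun z => inner ℝ (γ z - c) (N z)) y :=
  ((h.differentiableAt_map hy).sub_const c).inner ℝ (h.differentiableAt_normal hy)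

/-- The principal curvature function of a totally umbilical patch of dimension at least two is
locally constant. -/
theorem fderiv_eq_zero_of_umbilical [FiniteDimensional ℝ T] (hT : 2 ≤ Module.finrank ℝ T)
    (h : IsOrientedPatch γ N Ω) {μ : T → ℝ}
    (hμ : ∀ y ∈ Ω, DifferentiableAt ℝ μ y) (hN : ∀ y ∈ Ω, fderiv ℝ N y = μ y • fderiv ℝ γ y)
    {y : T} (hy : y ∈ Ω) : fderiv ℝ μ y = 0 := by
  have h1 : fderiv ℝ N =ᶠ[nhds y] fun z => μ z • fderiv ℝ γ z := by
    filter_upwards [h.isOpen.mem_nhds hy] with z hz using hN z hz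
  have hdγ : DifferentiableAt ℝ (fderiv ℝ γ) y :=
    (h.contDiffAt_fderiv_map hy).differentiableAt (by simp)
  have h2 : ∀ v w, fderiv ℝ (fderiv ℝ N) y v w =
      μ y • fderiv ℝ (fderiv ℝ γ) y v w + fderiv ℝ μ y v • fderiv ℝ γ y w := by
    intro v w
    rw [h1.fderiv_eq, fderiv_fun_smul (hμ y hy) hdγ]
    simp
  have hsN : IsSymmSndFDerivAt ℝ N y := (h.contDiffAt_normal hy).isSymmSndFDerivAt
    (by simp [minSmoothness_of_isRCLikeNormedField]; norm_cast)
  have hsγ : IsSymmSndFDerivAt ℝ γ y := (h.contDiffAt_map hy).isSymmSndFDerivAt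
    (by simp [minSmoothness_of_isRCLikeNormedField]; norm_cast)
  -- Differentiate `dN = μ dγ`: the second derivatives of `N` and `γ` are symmetric, so the term
  -- `dμ(v) dγ(w)` is symmetric too. If `dμ ≠ 0`, every vector is then a multiple of a single one,
  -- against dimension at least two.
  have h3 : ∀ v w, fderiv ℝ μ y v • w = fderiv ℝ μ y w • v := by
    intro v w
    apply h.injective y hy
    have h4 := h2 v w
    rw [hsN.eq v w, h2 w v, hsγ.eq v w] at h4
    rw [map_smul, map_smul]
    exact (add_left_cancel h4).symm
  by_contra hne
  obtain ⟨v, hv⟩ : ∃ v, fderiv ℝ μ y v ≠ 0 := by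
    by_contra hcon
    push Not at hcon
    exact hne (ContinuousLinearMap.ext hcon)
  have h4 : Module.finrank ℝ T ≤ 1 := finrank_le_one v fun w =>
    ⟨(fderiv ℝ μ y v)⁻¹ * fderiv ℝ μ y w, by rw [mul_smul, ← h3, smul_smul, inv_mul_cancel₀ hv,
      one_smul]⟩
  omega

/-- Umbilicity is immediate where the support function is nonzero, and it is a closed condition. If
it failed at a point, the support function would vanish on an open set; there the position vector is
both tangent and orthogonal to the whole tangent space, so `γ = 0`, which is impossible for an
immersion. -/
theorem umbilical_of_dense [FiniteDimensional ℝ T] (hT : 2 ≤ Module.finrank ℝ T)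
    (h : IsOrientedPatch γ N Ω)
    (hsol : ∀ y ∈ Ω, ∃ κ : ℝ, inner ℝ (γ y) (N y) • fderiv ℝ N y = κ • fderiv ℝ γ y)
    (hinj : ∀ y ∈ Ω, Function.Injective (fderiv ℝ N y)) :
    ∃ μ : T → ℝ, (∀ y ∈ Ω, DifferentiableAt ℝ μ y) ∧
      ∀ y ∈ Ω, fderiv ℝ N y = μ y • fderiv ℝ γ y := by
  have : Nontrivial T := Module.nontrivial_of_finrank_pos (R := ℝ) (by omega)
  obtain ⟨e, he⟩ := exists_ne (0 : T)
  have hpos : ∀ y ∈ Ω, inner ℝ (fderiv ℝ γ y e) (fderiv ℝ γ y e) ≠ (0 : ℝ) := by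
    intro y hy h0
    rw [inner_self_eq_zero] at h0
    exact he (h.injective y hy (h0.trans (map_zero _).symm))
  -- A quotient in one fixed direction `e` gives a candidate for the curvature that is
  -- differentiable even where the support function vanishes.
  set μ : T → ℝ := fun y =>
    inner ℝ (fderiv ℝ N y e) (fderiv ℝ γ y e) / inner ℝ (fderiv ℝ γ y e) (fderiv ℝ γ y e) with hμ
  have hdiff : ∀ y ∈ Ω, DifferentiableAt ℝ μ y := by
    intro y hy
    have h1 : DifferentiableAt ℝ (fun z => fderiv ℝ γ z e) y :=
      ((h.contDiffAt_fderiv_map hy).differentiableAt (by simp)).clm_apply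
        (differentiableAt_const e)
    have h2 : DifferentiableAt ℝ (fun z => fderiv ℝ N z e) y :=
      ((h.contDiffAt_fderiv_normal hy).differentiableAt (by simp)).clm_apply
        (differentiableAt_const e)
    have h3 : DifferentiableAt ℝ (fun z => inner ℝ (fderiv ℝ N z e) (fderiv ℝ γ z e)) y :=
      h2.inner ℝ h1
    have h4 : DifferentiableAt ℝ (fun z => inner ℝ (fderiv ℝ γ z e) (fderiv ℝ γ z e)) y :=
      h1.inner ℝ h1
    simp only [hμ, div_eq_mul_inv]
    exact h3.fun_mul (h4.fun_inv (hpos y hy))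
  refine ⟨μ, hdiff, fun y hy => ?_⟩
  by_contra hne
  have hcont : ContinuousAt (fun z => fderiv ℝ N z - μ z • fderiv ℝ γ z) y :=
    (h.contDiffAt_fderiv_normal hy).continuousAt.sub
      ((hdiff y hy).continuousAt.smul (h.contDiffAt_fderiv_map hy).continuousAt)
  have hev : ∀ᶠ z in nhds y, inner ℝ (γ z) (N z) = (0 : ℝ) := by
    filter_upwards [hcont.eventually_ne (sub_ne_zero.2 hne), h.isOpen.mem_nhds hy] with z hz hzΩ
    by_contra hu
    apply hz
    obtain ⟨κ, hκ⟩ := hsol z hzΩ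
    have h1 : fderiv ℝ N z = ((inner ℝ (γ z) (N z))⁻¹ * κ) • fderiv ℝ γ z := by
      rw [mul_smul, ← hκ, smul_smul, inv_mul_cancel₀ hu, one_smul]
    have h2 : μ z = (inner ℝ (γ z) (N z))⁻¹ * κ := by
      rw [hμ]
      simp only
      rw [h1, smul_apply, real_inner_smul_left, mul_div_assoc,
        div_self (hpos z hzΩ), mul_one]
    rw [h2, ← h1, sub_self]
  have hev2 : ∀ᶠ z in nhds y, γ z = 0 := by
    filter_upwards [hev.eventually_nhds, h.isOpen.mem_nhds hy] with z hz hzΩ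
    have hd : ∀ v, inner ℝ (γ z) (fderiv ℝ N z v) = 0 := by
      intro v
      have h1 := h.fderiv_support hzΩ 0 v
      simp only [sub_zero] at h1
      have h2 : (fun z => inner ℝ (γ z) (N z)) =ᶠ[nhds z] fun _ => (0 : ℝ) := hz
      rw [← h1, h2.fderiv_eq]
      simp
    have hle : LinearMap.range (fderiv ℝ N z).toLinearMap ≤
        LinearMap.range (fderiv ℝ γ z).toLinearMap := by
      rintro _ ⟨v, rfl⟩
      obtain ⟨w, hw⟩ := (h.orthogonal_iff z hzΩ _).1 (h.inner_fderiv_normal hzΩ v)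
      exact ⟨w, hw⟩
    -- Injectivity of `dN` makes its range the full tangent space, so orthogonality of `γ z` to this
    -- range, together with its tangency, gives `γ z = 0`.
    have heq := Submodule.eq_of_le_of_finrank_eq hle (by
      rw [LinearMap.finrank_range_of_inj (hinj z hzΩ),
        LinearMap.finrank_range_of_inj (h.injective z hzΩ)])
    obtain ⟨w, hw⟩ := (h.orthogonal_iff z hzΩ (γ z)).1
      (by rw [real_inner_comm]; exact hz.self_of_nhds)
    have hmem : γ z ∈ LinearMap.range (fderiv ℝ N z).toLinearMap := heq ▸ ⟨w, hw⟩
    obtain ⟨v, hv⟩ := hmem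
    have h5 := hd v
    rw [show fderiv ℝ N z v = γ z from hv] at h5
    exact inner_self_eq_zero.1 h5
  have h6 : γ =ᶠ[nhds y] fun _ => (0 : E) := hev2
  have h7 : fderiv ℝ γ y = 0 := by rw [h6.fderiv_eq]; simp
  exact he (h.injective y hy (by rw [h7]; simp))

/-- Near a point with nondegenerate second fundamental form, a solution of the soliton equation is
totally umbilical with constant nonzero principal curvature. -/
theorem exists_umbilical [FiniteDimensional ℝ T] (hT : 2 ≤ Module.finrank ℝ T)
    (h : IsOrientedPatch γ N Ω)
    (hsol : ∀ y ∈ Ω, ∃ κ : ℝ, inner ℝ (γ y) (N y) • fderiv ℝ N y = κ • fderiv ℝ γ y)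
    {y₀ : T} (hy₀ : y₀ ∈ Ω) (hinj : Function.Injective (fderiv ℝ N y₀)) :
    ∃ (μ : ℝ) (a : E), μ ≠ 0 ∧
      ∀ᶠ y in nhds y₀, fderiv ℝ N y = μ • fderiv ℝ γ y ∧ N y - μ • γ y = a := by
  have hio : {y | Function.Injective (fderiv ℝ N y)} ∈ nhds y₀ :=
    (h.contDiffAt_fderiv_normal hy₀).continuousAt.preimage_mem_nhds
      (ContinuousLinearMap.isOpen_injective.mem_nhds hinj)
  obtain ⟨ε, hε, hball⟩ := Metric.mem_nhds_iff.1 (Filter.inter_mem hio (h.isOpen.mem_nhds hy₀))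
  have hB := h.mono Metric.isOpen_ball (fun z hz => (hball hz).2)
  obtain ⟨μ, hμd, hμ⟩ := hB.umbilical_of_dense hT (fun z hz => hsol z (hball hz).2)
    (fun z hz => (hball hz).1)
  have hpre : IsPreconnected (Metric.ball y₀ ε) := (convex_ball y₀ ε).isPreconnected
  have hy₀B : y₀ ∈ Metric.ball y₀ ε := Metric.mem_ball_self hε
  have hc : ∀ z ∈ Metric.ball y₀ ε, μ z = μ y₀ := fun z hz =>
    Metric.isOpen_ball.is_const_of_fderiv_eq_zero (𝕜 := ℝ) hpre
      (fun w hw => (hμd w hw).differentiableWithinAt)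
      (fun w hw => hB.fderiv_eq_zero_of_umbilical hT hμd hμ hw) hz hy₀B
  have hμ' : ∀ z ∈ Metric.ball y₀ ε, fderiv ℝ N z = μ y₀ • fderiv ℝ γ z := fun z hz => by
    rw [hμ z hz, hc z hz]
  have hd : ∀ z ∈ Metric.ball y₀ ε, N z - μ y₀ • γ z = N y₀ - μ y₀ • γ y₀ := fun z hz =>
    Metric.isOpen_ball.is_const_of_fderiv_eq_zero (𝕜 := ℝ) (f := fun z => N z - μ y₀ • γ z) hpre
      (fun w hw => ((hB.differentiableAt_normal hw).sub
        ((hB.differentiableAt_map hw).const_smul _)).differentiableWithinAt)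
      (fun w hw => by
        rw [fderiv_fun_sub (hB.differentiableAt_normal hw)
          ((hB.differentiableAt_map hw).fun_const_smul _),
          fderiv_fun_const_smul (hB.differentiableAt_map hw), hμ' w hw, sub_self]; rfl) hz hy₀B
  refine ⟨μ y₀, N y₀ - μ y₀ • γ y₀, fun h0 => ?_, ?_⟩
  · have : Nontrivial T := Module.nontrivial_of_finrank_pos (R := ℝ) (by omega)
    obtain ⟨e, he⟩ := exists_ne (0 : T)
    exact he (hinj (by rw [hμ y₀ hy₀B, h0]; simp))
  · filter_upwards [Metric.ball_mem_nhds y₀ hε] with z hz using ⟨hμ' z hz, hd z hz⟩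

/-- A patch contained in a sphere: the position relative to the centre is a constant multiple of
the normal to first order. -/
theorem eq_smul_normal_of_sphere (h : IsOrientedPatch γ N Ω) {c : E} {r : ℝ} {y : T} (hy : y ∈ Ω)
    (hs : ∀ᶠ z in nhds y, γ z ∈ Metric.sphere c r) :
    (inner ℝ (γ y - c) (N y)) ^ 2 = r ^ 2 ∧ γ y - c = inner ℝ (γ y - c) (N y) • N y ∧
      fderiv ℝ γ y = inner ℝ (γ y - c) (N y) • fderiv ℝ N y := by
  have key : ∀ᶠ z in nhds y, z ∈ Ω ∧ γ z - c = inner ℝ (γ z - c) (N z) • N z := by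
    filter_upwards [hs.eventually_nhds, h.isOpen.mem_nhds hy] with z hz hzΩ
    refine ⟨hzΩ, ?_⟩
    have hperp : ∀ v, inner ℝ (γ z - c) (fderiv ℝ γ z v) = 0 := by
      intro v
      have h1 : (fun w => inner ℝ (γ w - c) (γ w - c)) =ᶠ[nhds z] fun _ => r ^ 2 := by
        filter_upwards [hz] with w hw
        rw [real_inner_self_eq_norm_sq, mem_sphere_iff_norm.1 hw]
      have hd : DifferentiableAt ℝ (fun w => γ w - c) z := (h.differentiableAt_map hzΩ).sub_const c
      have h2 := fderiv_inner_apply ℝ hd hd v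
      rw [h1.fderiv_eq, fderiv_sub_const, real_inner_comm (γ z - c) (fderiv ℝ γ z v)] at h2
      simp only [fderiv_fun_const, Pi.zero_apply, zero_apply] at h2
      linarith
    obtain ⟨v, hv⟩ := (h.orthogonal_iff z hzΩ
      (γ z - c - inner ℝ (γ z - c) (N z) • N z)).1 (by
        rw [inner_sub_right, real_inner_smul_right, h.inner_self hzΩ,
          real_inner_comm (γ z - c) (N z)]; ring)
    have h3 := hperp v
    have h4 := h.inner_fderiv_map hzΩ v
    rw [hv] at h3 h4
    have h5 : inner ℝ (γ z - c - inner ℝ (γ z - c) (N z) • N z)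
        (γ z - c - inner ℝ (γ z - c) (N z) • N z) = (0 : ℝ) := by
      rw [inner_sub_left, h3, real_inner_smul_left, h4]; ring
    exact sub_eq_zero.1 (inner_self_eq_zero.1 h5)
  have hy' := key.self_of_nhds.2
  set s : T → ℝ := fun z => inner ℝ (γ z - c) (N z) with hsdef
  have hsd : DifferentiableAt ℝ s y := h.differentiableAt_support hy c
  -- The derivative of `s` is `⟨γ - c, dN⟩`, and `γ - c` is parallel to `N`, which is orthogonal to
  -- `dN`.
  have hds : fderiv ℝ s y = 0 := by
    ext v
    rw [h.fderiv_support hy c v, hy', real_inner_smul_left, h.inner_fderiv_normal hy v]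
    simp
  refine ⟨?_, hy', ?_⟩
  · have h1 := hs.self_of_nhds
    rw [mem_sphere_iff_norm] at h1
    rw [← h1, ← real_inner_self_eq_norm_sq]
    conv_rhs => rw [hy']
    rw [real_inner_smul_left, real_inner_smul_right, h.inner_self hy]
    ring
  · have h1 : (fun z => γ z - c) =ᶠ[nhds y] fun z => s z • N z := by
      filter_upwards [key] with z hz using hz.2
    have h2 := h1.fderiv_eq (𝕜 := ℝ)
    rw [fderiv_sub_const, fderiv_fun_smul hsd (h.differentiableAt_normal hy), hds] at h2
    rw [h2]
    ext v
    simp [hsdef]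

/-- A solution of the soliton equation which accumulates at an interior point on a sphere is
spherical near that point. -/
theorem eventually_sphere_of_frequently [FiniteDimensional ℝ T] (hT : 2 ≤ Module.finrank ℝ T)
    (h : IsOrientedPatch γ N Ω)
    (hsol : ∀ y ∈ Ω, ∃ κ : ℝ, inner ℝ (γ y) (N y) • fderiv ℝ N y = κ • fderiv ℝ γ y)
    {c : E} {r : ℝ} (hr : 0 < r) {y₀ : T} (hy₀ : y₀ ∈ Ω)
    (hs : ∃ᶠ y in nhds y₀, ∀ᶠ z in nhds y, γ z ∈ Metric.sphere c r) :
    ∀ᶠ z in nhds y₀, γ z ∈ Metric.sphere c r := by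
  have hfr : ∃ᶠ y in nhds y₀, (inner ℝ (γ y - c) (N y)) ^ 2 = r ^ 2 ∧
      γ y - c = inner ℝ (γ y - c) (N y) • N y ∧
      fderiv ℝ γ y = inner ℝ (γ y - c) (N y) • fderiv ℝ N y :=
    (hs.and_eventually (h.isOpen.mem_nhds hy₀)).mono fun y hy =>
      h.eq_smul_normal_of_sphere hy.2 hy.1
  have cs : ContinuousAt (fun y => inner ℝ (γ y - c) (N y)) y₀ :=
    (h.differentiableAt_support hy₀ c).continuousAt
  have cγ := (h.differentiableAt_map hy₀).continuousAt
  have cN := (h.differentiableAt_normal hy₀).continuousAt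
  have cdγ := (h.contDiffAt_fderiv_map hy₀).continuousAt
  have cdN := (h.contDiffAt_fderiv_normal hy₀).continuousAt
  have e1 : (inner ℝ (γ y₀ - c) (N y₀)) ^ 2 = r ^ 2 := eq_of_frequently_eq (x := y₀)
    (a := fun y => (inner ℝ (γ y - c) (N y)) ^ 2) (b := fun _ => r ^ 2) (cs.pow 2)
    continuousAt_const (hfr.mono fun y hy => hy.1)
  have e2 : γ y₀ - c = inner ℝ (γ y₀ - c) (N y₀) • N y₀ :=
    eq_of_frequently_eq (cγ.sub continuousAt_const) (cs.smul cN) (hfr.mono fun y hy => hy.2.1)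
  have e3 : fderiv ℝ γ y₀ = inner ℝ (γ y₀ - c) (N y₀) • fderiv ℝ N y₀ :=
    eq_of_frequently_eq cdγ (cs.smul cdN) (hfr.mono fun y hy => hy.2.2)
  set s := inner ℝ (γ y₀ - c) (N y₀) with hsdef
  have hs0 : s ≠ 0 := by
    intro h0
    rw [h0] at e1
    have := pow_pos hr 2
    linarith
  -- The limiting identity `dγ = s dN` with `s² = r² > 0` keeps `dN` injective at the limit point,
  -- so the umbilical result applies there.
  have hinj : Function.Injective (fderiv ℝ N y₀) := by
    intro v w hvw
    apply h.injective y₀ hy₀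
    rw [e3, smul_apply, smul_apply, hvw]
  obtain ⟨μ, a, hμ0, hev⟩ := h.exists_umbilical hT hsol hy₀ hinj
  obtain ⟨f1, f2⟩ := hev.self_of_nhds
  have hsμ : s * μ = 1 := by
    have : Nontrivial T := Module.nontrivial_of_finrank_pos (R := ℝ) (by omega)
    obtain ⟨e, he⟩ := exists_ne (0 : T)
    rw [f1, smul_smul] at e3
    by_contra hne
    apply he
    apply h.injective y₀ hy₀
    rw [map_zero]
    have h5 := congrArg (fun A => A e) e3
    simp only [smul_apply] at h5
    have h6 : (s * μ - 1) • fderiv ℝ γ y₀ e = 0 := by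
      rw [sub_smul, ← h5, one_smul, sub_self]
    exact (smul_eq_zero.1 h6).resolve_left (sub_ne_zero.2 hne)
  -- The sphere found near `y₀` has centre `-μ⁻¹ a` and `s = μ⁻¹`, so its centre is the prescribed
  -- `c`.
  have ha : s • a = - c := by
    rw [← f2, smul_sub, ← e2, smul_smul, hsμ, one_smul]
    abel
  filter_upwards [hev, h.isOpen.mem_nhds hy₀] with z hz hzΩ
  have h7 : γ z - c = s • N z := by
    have h8 : N z = a + μ • γ z := by rw [← hz.2]; abel
    rw [h8, smul_add, ha, smul_smul, hsμ, one_smul]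
    abel
  rw [mem_sphere_iff_norm, h7, norm_smul, h.norm_normal z hzΩ, mul_one, Real.norm_eq_abs,
    ← abs_of_pos hr]
  exact sq_eq_sq_iff_abs_eq_abs _ _ |>.1 e1

theorem exists_sphere [FiniteDimensional ℝ T] (hT : 2 ≤ Module.finrank ℝ T)
    (h : IsOrientedPatch γ N Ω)
    (hsol : ∀ y ∈ Ω, ∃ κ : ℝ, inner ℝ (γ y) (N y) • fderiv ℝ N y = κ • fderiv ℝ γ y)
    {y₀ : T} (hy₀ : y₀ ∈ Ω) (hinj : Function.Injective (fderiv ℝ N y₀)) :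
    ∃ (c : E) (r : ℝ), 0 < r ∧ ∀ᶠ z in nhds y₀, γ z ∈ Metric.sphere c r := by
  obtain ⟨μ, a, hμ0, hev⟩ := h.exists_umbilical hT hsol hy₀ hinj
  -- Solve `N - μ γ = a` for `γ`.
  refine ⟨-(μ⁻¹ • a), |μ⁻¹|, abs_pos.2 (inv_ne_zero hμ0), ?_⟩
  filter_upwards [hev, h.isOpen.mem_nhds hy₀] with z hz hzΩ
  have h7 : γ z - -(μ⁻¹ • a) = μ⁻¹ • N z := by
    rw [← hz.2, smul_sub, smul_smul, inv_mul_cancel₀ hμ0, one_smul]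
    abel
  rw [mem_sphere_iff_norm, h7, norm_smul, h.norm_normal z hzΩ, mul_one, Real.norm_eq_abs]

/-- If `κ ≠ 0`, injectivity of `dγ` would pass to `dN`. -/
theorem support_smul_fderiv_normal (h : IsOrientedPatch γ N Ω) {y : T} (hy : y ∈ Ω) {κ : ℝ}
    (hsol : inner ℝ (γ y) (N y) • fderiv ℝ N y = κ • fderiv ℝ γ y)
    (hinj : ¬ Function.Injective (fderiv ℝ N y)) :
    inner ℝ (γ y) (N y) • fderiv ℝ N y = 0 := by
  by_cases hκ : κ = 0
  · rw [hsol, hκ, zero_smul]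
  · refine absurd (fun v w hvw => h.injective y hy ?_) hinj
    have h1 : κ • fderiv ℝ γ y v = κ • fderiv ℝ γ y w := by
      rw [← smul_apply, ← smul_apply, ← hsol,
        smul_apply, smul_apply, hvw]
    exact smul_right_injective E hκ h1

theorem fderiv_norm_sq_support (h : IsOrientedPatch γ N Ω) {y : T} (hy : y ∈ Ω)
    (hu : inner ℝ (γ y) (N y) • fderiv ℝ N y = 0) :
    fderiv ℝ (fun z => (inner ℝ (γ z) (N z)) ^ 2) y = 0 := by
  have hd := h.differentiableAt_support hy 0
  have hf := h.fderiv_support hy 0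
  simp only [sub_zero] at hd hf
  ext v
  rw [fderiv_fun_pow 2 hd]
  simp only [smul_apply, hf, smul_eq_mul]
  have h1 : inner ℝ (γ y) ((inner ℝ (γ y) (N y) • fderiv ℝ N y) v) = (0 : ℝ) := by simp [hu]
  rw [smul_apply, real_inner_smul_right] at h1
  simp only [zero_apply, nsmul_eq_mul]
  push_cast
  linear_combination 2 * h1

theorem fderiv_support_smul_normal (h : IsOrientedPatch γ N Ω) {y : T} (hy : y ∈ Ω)
    (hu : inner ℝ (γ y) (N y) • fderiv ℝ N y = 0) (h0 : inner ℝ (γ y) (N y) ≠ 0) :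
    fderiv ℝ (fun z => inner ℝ (γ z) (N z) • N z) y = 0 := by
  have hd := h.differentiableAt_support hy 0
  have hf := h.fderiv_support hy 0
  simp only [sub_zero] at hd hf
  have hN : fderiv ℝ N y = 0 := (smul_eq_zero.1 hu).resolve_left h0
  have hs : fderiv ℝ (fun z => inner ℝ (γ z) (N z)) y = 0 := by
    ext v
    rw [hf v, hN]
    simp
  rw [fderiv_fun_smul hd (h.differentiableAt_normal hy), hN, hs]
  ext v
  simp

end IsOrientedPatch

end LocalGeometry

/-! ### Local graphs over a tangent space -/

section Graph

variable {n : ℕ} {M : Type*} [TopologicalSpace M] [ChartedSpace (EuclideanSpace ℝ (Fin n)) M]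

/-- `G` parametrizes a neighbourhood of `x₀` in the hypersurface `f` as a graph over the open
subset `Ω` of the tangent space at `x₀`. -/
structure IsGraphChart (f : M → EuclideanSpace ℝ (Fin (n + 1))) (x₀ : M)
    (G : tangentImage f x₀ → M) (Ω : Set (tangentImage f x₀)) : Prop where
  isOpen : IsOpen Ω
  mem : (tangentImage f x₀).orthogonalProjectionOnto (f x₀) ∈ Ω
  apply_base : G ((tangentImage f x₀).orthogonalProjectionOnto (f x₀)) = x₀
  smooth : ContMDiffOn 𝓘(ℝ, tangentImage f x₀) (𝓡 n) ∞ G Ω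
  isOpen_image : IsOpen (G '' Ω)
  projection : ∀ y ∈ Ω, (tangentImage f x₀).orthogonalProjectionOnto (f (G y)) = y

theorem IsHypersurface.finrank_tangentImage {f : M → EuclideanSpace ℝ (Fin (n + 1))}
    (hf : IsHypersurface f) (x : M) : Module.finrank ℝ (tangentImage f x) = n := by
  have h := LinearMap.finrank_range_of_inj (f := (differential f x).toLinearMap)
    (hf.injective_differential x)
  refine h.trans ?_
  change Module.finrank ℝ (EuclideanSpace ℝ (Fin n)) = n
  simp

/-- Inverse function theorem for `H`, the projection of `f` to the tangent space at `x₀`: its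
derivative at the base point is injective because the projection fixes tangent vectors there, and
the dimensions agree. -/
theorem IsHypersurface.exists_graphChart [IsManifold (𝓡 n) ∞ M]
    {f : M → EuclideanSpace ℝ (Fin (n + 1))} (hf : IsHypersurface f) (x₀ : M) :
    ∃ (G : tangentImage f x₀ → M) (Ω : Set (tangentImage f x₀)), IsGraphChart f x₀ G Ω := by
  set T := tangentImage f x₀ with hT
  set e := extChartAt (𝓡 n) x₀ with he
  set H : EuclideanSpace ℝ (Fin n) → T := fun z => T.orthogonalProjectionOnto (f (e.symm z)) with hH
  have hxt : e x₀ ∈ e.target := mem_extChartAt_target x₀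
  have hex : e.symm (e x₀) = x₀ := extChartAt_to_inv x₀
  have hto : IsOpen e.target := isOpen_extChartAt_target x₀
  have hFs : ContDiffOn ℝ ∞ (f ∘ e.symm) e.target :=
    (hf.smooth.comp_contMDiffOn (contMDiffOn_extChartAt_symm (I := 𝓡 n) (n := ∞) x₀)).contDiffOn
  have hHs : ContDiffOn ℝ ∞ H e.target := T.orthogonalProjectionOnto.contDiff.comp_contDiffOn hFs
  have hHat : ∀ z ∈ e.target, ContDiffAt ℝ ∞ H z := fun z hz => hHs.contDiffAt (hto.mem_nhds hz)
  have hfr : Module.finrank ℝ (EuclideanSpace ℝ (Fin n)) = Module.finrank ℝ T := by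
    rw [hf.finrank_tangentImage x₀]; simp
  have hequiv : ∀ z, Function.Injective (fderiv ℝ H z) →
      ∃ A : EuclideanSpace ℝ (Fin n) ≃L[ℝ] T,
        (A : EuclideanSpace ℝ (Fin n) →L[ℝ] T) = fderiv ℝ H z := by
    intro z hz
    refine ⟨(LinearEquiv.ofInjectiveOfFinrankEq (fderiv ℝ H z).toLinearMap hz
      hfr).toContinuousLinearEquiv, ?_⟩
    ext v
    rfl
  have hinj : Function.Injective (fderiv ℝ H (e x₀)) := by
    rw [injective_iff_map_eq_zero]
    intro w hw
    have hd : DifferentiableAt ℝ (f ∘ e.symm) (e x₀) :=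
      (hFs.contDiffAt (hto.mem_nhds hxt)).differentiableAt (by simp)
    have h1 : fderiv ℝ H (e x₀) = T.orthogonalProjectionOnto.comp (fderiv ℝ (f ∘ e.symm) (e x₀)) :=
      (T.orthogonalProjectionOnto.hasFDerivAt.comp (e x₀) hd.hasFDerivAt).fderiv
    have h2 := mvfderiv_inverse_mfderiv_extChartAt x₀ (k := f)
      ((hf.smooth _).mdifferentiableAt (by simp)) w
    rw [h1, ContinuousLinearMap.comp_apply, ← h2] at hw
    have h3 := Submodule.starProjection_eq_self_iff.2 (differential_mem_tangentImage f x₀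
      ((mfderiv (𝓡 n) 𝓘(ℝ, EuclideanSpace ℝ (Fin n)) e x₀).inverse w))
    have hw' : T.orthogonalProjectionOnto (differential f x₀
      ((mfderiv (𝓡 n) 𝓘(ℝ, EuclideanSpace ℝ (Fin n)) e x₀).inverse w)) = 0 := hw
    rw [← hT, Submodule.starProjection_apply, hw', Submodule.coe_zero] at h3
    have h4 := hf.injective_differential x₀ (h3.symm.trans (map_zero (differential f x₀)).symm)
    have hinv := isInvertible_mfderiv_extChartAt (I := 𝓡 n) (mem_extChartAt_source x₀ (I := 𝓡 n))
    have h5 := congrArg (fun A => A w) hinv.self_comp_inverse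
    change (mfderiv (𝓡 n) 𝓘(ℝ, EuclideanSpace ℝ (Fin n)) e x₀)
      ((mfderiv (𝓡 n) 𝓘(ℝ, EuclideanSpace ℝ (Fin n)) e x₀).inverse w) = w at h5
    rw [h4, map_zero] at h5
    exact h5.symm
  obtain ⟨A, hA⟩ := hequiv _ hinj
  have hstrict : HasFDerivAt H (A : EuclideanSpace ℝ (Fin n) →L[ℝ] T) (e x₀) := by
    rw [hA]; exact ((hHat _ hxt).differentiableAt (by simp)).hasFDerivAt
  set h := (hHat _ hxt).toOpenPartialHomeomorph H hstrict (by simp) with hh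
  have hcoe : ∀ z, h z = H z := fun z => rfl
  have hx0 : e x₀ ∈ h.source := (hHat _ hxt).mem_toOpenPartialHomeomorph_source hstrict (by simp)
  -- Shrinking to points where the derivative stays invertible makes the local inverse smooth on a
  -- whole open set, not only at the base point.
  set S := h.source ∩ (e.target ∩ (fderiv ℝ H) ⁻¹' {B | Function.Injective B}) with hS
  have hSo : IsOpen S := by
    refine h.open_source.inter (ContinuousOn.isOpen_inter_preimage ?_ hto
      ContinuousLinearMap.isOpen_injective)
    exact hHs.continuousOn_fderiv_of_isOpen hto (by simp)
  have hGimg : (e.symm ∘ h.symm) '' (h.target ∩ h.symm ⁻¹' S) = e.source ∩ e ⁻¹' S := by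
    ext x
    constructor
    · rintro ⟨y, ⟨hy, hyS⟩, rfl⟩
      simp only [Function.comp_apply, Set.mem_inter_iff, Set.mem_preimage] at hyS ⊢
      exact ⟨e.map_target hyS.2.1, by rw [e.right_inv hyS.2.1]; exact hyS⟩
    · rintro ⟨hx, hxS⟩
      refine ⟨h (e x), ⟨h.map_source hxS.1, ?_⟩, ?_⟩
      · rw [Set.mem_preimage, h.left_inv hxS.1]; exact hxS
      · simp only [Function.comp_apply]
        rw [h.left_inv hxS.1, e.left_inv hx]
  have hHx : H (e x₀) = T.orthogonalProjectionOnto (f x₀) := by simp only [hH, hex]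
  have hsym : h.symm (T.orthogonalProjectionOnto (f x₀)) = e x₀ := by
    rw [← hHx, ← hcoe, h.left_inv hx0]
  refine ⟨e.symm ∘ h.symm, h.target ∩ h.symm ⁻¹' S, ?_, ?_, ?_, ?_, ?_, ?_⟩
  · exact h.symm.isOpen_inter_preimage hSo
  · refine ⟨?_, ?_⟩
    · rw [← hHx, ← hcoe]; exact h.map_source hx0
    · rw [Set.mem_preimage, hsym]; exact ⟨hx0, hxt, hinj⟩
  · simp only [Function.comp_apply]
    rw [hsym, hex]
  · have h1 : ContDiffOn ℝ ∞ h.symm (h.target ∩ h.symm ⁻¹' S) := by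
      rintro y ⟨hy, hyS⟩
      obtain ⟨B, hB⟩ := hequiv _ hyS.2.2
      refine (h.contDiffAt_symm hy (f₀' := B) ?_ (hHat _ hyS.2.1)).contDiffWithinAt
      rw [hB]
      exact ((hHat _ hyS.2.1).differentiableAt (by simp)).hasFDerivAt
    exact (contMDiffOn_extChartAt_symm (I := 𝓡 n) (n := ∞) x₀).comp h1.contMDiffOn
      (fun y hy => hy.2.2.1)
  · rw [hGimg]
    exact isOpen_extChartAt_preimage' x₀ hSo
  · rintro y ⟨hy, hyS⟩
    exact h.right_inv hy

end Graph

/-! ### Unit normals and the soliton equation on a graph -/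

section GraphPatch

variable {n : ℕ} {M : Type*} [TopologicalSpace M] [ChartedSpace (EuclideanSpace ℝ (Fin n)) M]
  {f : M → EuclideanSpace ℝ (Fin (n + 1))} {x₀ : M} {G : tangentImage f x₀ → M}
  {Ω : Set (tangentImage f x₀)}

theorem IsHypersurface.exists_unit_normal (hf : IsHypersurface f) (x : M) :
    ∃ ν : EuclideanSpace ℝ (Fin (n + 1)), ‖ν‖ = 1 ∧ ν ∈ (tangentImage f x)ᗮ := by
  have h1 := (tangentImage f x).finrank_add_finrank_orthogonal
  rw [hf.finrank_tangentImage x, finrank_euclideanSpace_fin] at h1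
  have : Nontrivial (tangentImage f x)ᗮ :=
    Module.nontrivial_of_finrank_pos (R := ℝ) (by omega)
  obtain ⟨⟨v, hv⟩, hne⟩ := exists_ne (0 : (tangentImage f x)ᗮ)
  have hv0 : v ≠ 0 := fun h => hne (by simp [h])
  refine ⟨(‖v‖)⁻¹ • v, ?_, Submodule.smul_mem _ _ hv⟩
  rw [norm_smul, norm_inv, norm_norm, inv_mul_cancel₀ (norm_ne_zero_iff.2 hv0)]

/-- Vectors orthogonal to a unit normal are tangent. -/
theorem IsHypersurface.mem_tangentImage_iff (hf : IsHypersurface f) {x : M}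
    {ν : EuclideanSpace ℝ (Fin (n + 1))} (hν : ν ≠ 0) (hνT : ν ∈ (tangentImage f x)ᗮ)
    {w : EuclideanSpace ℝ (Fin (n + 1))} : w ∈ tangentImage f x ↔ inner ℝ ν w = 0 := by
  have hle : tangentImage f x ≤ (Submodule.span ℝ {ν})ᗮ := by
    intro z hz
    rw [Submodule.mem_orthogonal_singleton_iff_inner_right]
    exact Submodule.inner_left_of_mem_orthogonal hz hνT
  have : Fact (Module.finrank ℝ (EuclideanSpace ℝ (Fin (n + 1))) = n + 1) := ⟨by simp⟩
  have heq := Submodule.eq_of_le_of_finrank_eq hle (by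
    rw [hf.finrank_tangentImage x, Submodule.finrank_orthogonal_span_singleton (n := n) hν])
  rw [heq, Submodule.mem_orthogonal_singleton_iff_inner_right]

namespace IsGraphChart

theorem contDiffOn (h : IsGraphChart f x₀ G Ω) (hf : IsHypersurface f) :
    ContDiffOn ℝ ∞ (f ∘ G) Ω := (hf.smooth.comp_contMDiffOn h.smooth).contDiffOn

theorem mdifferentiableAt (h : IsGraphChart f x₀ G Ω) {y : tangentImage f x₀} (hy : y ∈ Ω) :
    MDifferentiableAt 𝓘(ℝ, tangentImage f x₀) (𝓡 n) G y :=
  (h.smooth.contMDiffAt (h.isOpen.mem_nhds hy)).mdifferentiableAt (by simp)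

theorem fderiv_comp {E : Type*} [NormedAddCommGroup E] [NormedSpace ℝ E]
    (h : IsGraphChart f x₀ G Ω) {k : M → E} (hk : ContMDiff (𝓡 n) 𝓘(ℝ, E) ∞ k)
    {y : tangentImage f x₀} (hy : y ∈ Ω) (v : tangentImage f x₀) :
    fderiv ℝ (k ∘ G) y v = mvfderiv (𝓡 n) k (G y)
      (mfderiv 𝓘(ℝ, tangentImage f x₀) (𝓡 n) G y v) := by
  have h1 : mfderiv 𝓘(ℝ, tangentImage f x₀) 𝓘(ℝ, E) (k ∘ G) y = _ :=
    mfderiv_comp y ((hk _).mdifferentiableAt (by simp)) (h.mdifferentiableAt hy)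
  rw [mfderiv_eq_fderiv] at h1
  rw [h1]
  rfl

theorem projection_fderiv (h : IsGraphChart f x₀ G Ω) (hf : IsHypersurface f)
    {y : tangentImage f x₀} (hy : y ∈ Ω) (v : tangentImage f x₀) :
    (tangentImage f x₀).orthogonalProjectionOnto (fderiv ℝ (f ∘ G) y v) = v := by
  have hd : DifferentiableAt ℝ (f ∘ G) y :=
    ((h.contDiffOn hf).contDiffAt (h.isOpen.mem_nhds hy)).differentiableAt (by simp)
  have h1 := ((tangentImage f x₀).orthogonalProjectionOnto.hasFDerivAt.comp y hd.hasFDerivAt).fderiv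
  have h2 : (tangentImage f x₀).orthogonalProjectionOnto ∘ (f ∘ G) =ᶠ[nhds y] id := by
    filter_upwards [h.isOpen.mem_nhds hy] with z hz using h.projection z hz
  rw [h2.fderiv_eq, fderiv_id] at h1
  rw [← ContinuousLinearMap.comp_apply, ← h1]
  rfl

theorem injective_fderiv (h : IsGraphChart f x₀ G Ω) (hf : IsHypersurface f)
    {y : tangentImage f x₀} (hy : y ∈ Ω) : Function.Injective (fderiv ℝ (f ∘ G) y) :=
  Function.LeftInverse.injective (h.projection_fderiv hf hy)

theorem exists_fderiv_eq_iff (h : IsGraphChart f x₀ G Ω) (hf : IsHypersurface f)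
    {y : tangentImage f x₀} (hy : y ∈ Ω) {w : EuclideanSpace ℝ (Fin (n + 1))} :
    (∃ v, fderiv ℝ (f ∘ G) y v = w) ↔ w ∈ tangentImage f (G y) := by
  have hle : LinearMap.range (fderiv ℝ (f ∘ G) y).toLinearMap ≤ tangentImage f (G y) := by
    rintro _ ⟨v, rfl⟩
    exact ⟨_, (h.fderiv_comp hf.smooth hy v).symm⟩
  have heq := Submodule.eq_of_le_of_finrank_eq hle (by
    rw [LinearMap.finrank_range_of_inj (h.injective_fderiv hf hy), hf.finrank_tangentImage,
      hf.finrank_tangentImage])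
  rw [← heq]
  rfl

theorem exists_orientedPatch (h : IsGraphChart f x₀ G Ω) (hf : IsHypersurface f) :
    ∃ N : tangentImage f x₀ → EuclideanSpace ℝ (Fin (n + 1)), IsOrientedPatch (f ∘ G) N Ω := by
  obtain ⟨ν, hν1, hνT⟩ := hf.exists_unit_normal x₀
  set b := stdOrthonormalBasis ℝ (tangentImage f x₀)
  set a : tangentImage f x₀ → tangentImage f x₀ := fun y =>
    ∑ i, inner ℝ ν (fderiv ℝ (f ∘ G) y (b i)) • b i with ha
  -- The usual normal of a graph: `a` is the gradient of the height `⟨ν, γ⟩`. It never vanishes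
  -- since `⟨m, ν⟩ = 1`.
  set m : tangentImage f x₀ → EuclideanSpace ℝ (Fin (n + 1)) := fun y =>
    ν - (a y : tangentImage f x₀) with hm
  have haν : ∀ z : tangentImage f x₀, inner ℝ ν (z : EuclideanSpace ℝ (Fin (n + 1))) = (0 : ℝ) :=
    fun z => Submodule.inner_left_of_mem_orthogonal z.2 hνT
  have hmν : ∀ y, inner ℝ (m y) ν = (1 : ℝ) := by
    intro y
    rw [hm, inner_sub_left, real_inner_self_eq_norm_sq, hν1, real_inner_comm, haν]
    norm_num
  have hm0 : ∀ y, m y ≠ 0 := by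
    intro y h0
    have := hmν y
    rw [h0, inner_zero_left] at this
    exact zero_ne_one this
  have hperp : ∀ y ∈ Ω, ∀ v, inner ℝ (m y) (fderiv ℝ (f ∘ G) y v) = (0 : ℝ) := by
    intro y hy v
    have h1 : inner ℝ ((a y : tangentImage f x₀) : EuclideanSpace ℝ (Fin (n + 1)))
        (fderiv ℝ (f ∘ G) y v) =
        inner ℝ (a y) v := by
      rw [← Submodule.inner_orthogonalProjectionOnto_eq_of_mem_left, h.projection_fderiv hf hy]
    have h2 : inner ℝ (a y) v = inner ℝ ν (fderiv ℝ (f ∘ G) y v) := by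
      conv_rhs => rw [← b.sum_repr v]
      rw [map_sum, inner_sum, ha, sum_inner]
      refine Finset.sum_congr rfl fun i _ => ?_
      rw [map_smul, real_inner_smul_right, b.repr_apply_apply]
      exact (real_inner_smul_left (F := tangentImage f x₀) _ _ _).trans (mul_comm _ _)
    rw [hm, inner_sub_left, h1, h2, sub_self]
  have hms : ContDiffOn ℝ ∞ m Ω := by
    have hd : ContDiffOn ℝ ∞ (fderiv ℝ (f ∘ G)) Ω :=
      (h.contDiffOn hf).fderiv_of_isOpen h.isOpen le_rfl
    have has : ContDiffOn ℝ ∞ a Ω := by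
      refine ContDiffOn.sum fun i _ => ?_
      exact (contDiffOn_const.inner ℝ (hd.clm_apply contDiffOn_const)).smul contDiffOn_const
    exact contDiffOn_const.sub ((tangentImage f x₀).subtypeL.contDiff.comp_contDiffOn has)
  refine ⟨fun y => ‖m y‖⁻¹ • m y, h.isOpen, h.contDiffOn hf, ?_, ?_, ?_, ?_⟩
  · exact ((hms.norm ℝ fun y _ => hm0 y).inv fun y _ => norm_ne_zero_iff.2 (hm0 y)).smul hms
  · intro y _
    rw [norm_smul, norm_inv, norm_norm, inv_mul_cancel₀ (norm_ne_zero_iff.2 (hm0 y))]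
  · exact fun y hy => h.injective_fderiv hf hy
  · intro y hy w
    rw [h.exists_fderiv_eq_iff hf hy, hf.mem_tangentImage_iff (hm0 y), real_inner_smul_left,
      mul_eq_zero, or_iff_right (inv_ne_zero (norm_ne_zero_iff.2 (hm0 y)))]
    rw [Submodule.mem_orthogonal']
    intro u hu
    obtain ⟨v, rfl⟩ := (h.exists_fderiv_eq_iff hf hy).2 hu
    exact hperp y hy v

theorem normalPart_eq (h : IsGraphChart f x₀ G Ω) (hf : IsHypersurface f)
    {N : tangentImage f x₀ → EuclideanSpace ℝ (Fin (n + 1))}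
    (hN : IsOrientedPatch (f ∘ G) N Ω) {y : tangentImage f x₀} (hy : y ∈ Ω) :
    normalPart f (G y) = inner ℝ ((f ∘ G) y) (N y) • N y := by
  have hperp : ∀ w ∈ tangentImage f (G y), inner ℝ (N y) w = (0 : ℝ) := fun w hw =>
    (hN.orthogonal_iff y hy w).2 ((h.exists_fderiv_eq_iff hf hy).2 hw)
  have h1 : inner ℝ ((f ∘ G) y) (N y) = inner ℝ (N y) (normalPart f (G y)) := by
    rw [normalPart, inner_sub_right, hperp _ (differential_mem_tangentImage f _ _), sub_zero,
      real_inner_comm]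
    rfl
  have h2 : normalPart f (G y) - inner ℝ ((f ∘ G) y) (N y) • N y ∈ tangentImage f (G y) := by
    rw [← h.exists_fderiv_eq_iff hf hy, ← hN.orthogonal_iff y hy, inner_sub_right,
      real_inner_smul_right, hN.inner_self hy, h1]
    ring
  have h3 : normalPart f (G y) - inner ℝ ((f ∘ G) y) (N y) • N y ∈ (tangentImage f (G y))ᗮ := by
    refine Submodule.sub_mem _ (normalPart_mem f _) (Submodule.smul_mem _ _ ?_)
    rw [Submodule.mem_orthogonal']
    exact hperp
  have h4 := Submodule.inner_right_of_mem_orthogonal h2 h3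
  exact sub_eq_zero.1 (inner_self_eq_zero.1 h4)

/-- The soliton equation in a local graph chart: where the support function does not vanish, the
chart is umbilical. -/
theorem support_smul_fderiv_normal [IsManifold (𝓡 n) ∞ M] [T2Space M]
    (h : IsGraphChart f x₀ G Ω) (hf : IsHypersurface f) {φ : M → ℝ}
    (hsol : IsConformalSoliton (inducedMetric f) (positionTangent f) φ)
    {N : tangentImage f x₀ → EuclideanSpace ℝ (Fin (n + 1))}
    (hN : IsOrientedPatch (f ∘ G) N Ω) {y : tangentImage f x₀} (hy : y ∈ Ω) :
    ∃ κ : ℝ, inner ℝ ((f ∘ G) y) (N y) • fderiv ℝ N y = κ • fderiv ℝ (f ∘ G) y := by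
  refine ⟨1 - φ (G y), ?_⟩
  ext1 v
  have hd : DifferentiableAt ℝ (fun z => inner ℝ ((f ∘ G) z) (N z)) y := by
    simpa only [sub_zero] using hN.differentiableAt_support hy 0
  have hξ : normalPart f ∘ G =ᶠ[nhds y] fun z => inner ℝ ((f ∘ G) z) (N z) • N z := by
    filter_upwards [h.isOpen.mem_nhds hy] with z hz using h.normalPart_eq hf hN hz
  have h1 := h.fderiv_comp (contMDiff_normalPart hf hsol.smooth_vectorField) hy v
  rw [hξ.fderiv_eq, fderiv_fun_smul hd (hN.differentiableAt_normal hy)] at h1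
  set z := (inner ℝ ((f ∘ G) y) (N y) • fderiv ℝ N y) v - ((1 - φ (G y)) • fderiv ℝ (f ∘ G) y) v
    with hz
  have hzperp : ∀ w, inner ℝ z (fderiv ℝ (f ∘ G) y w) = 0 := by
    intro w
    have h2 := hsol.inner_mvfderiv_normalPart hf (G y)
      (mfderiv 𝓘(ℝ, tangentImage f x₀) (𝓡 n) G y v) (mfderiv 𝓘(ℝ, tangentImage f x₀) (𝓡 n) G y w)
    rw [← h1] at h2
    simp only [differential] at h2
    rw [← h.fderiv_comp hf.smooth hy, ← h.fderiv_comp hf.smooth hy, add_apply, inner_add_left,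
      ContinuousLinearMap.smulRight_apply, real_inner_smul_left (N y),
      hN.inner_fderiv_map hy, mul_zero, add_zero] at h2
    rw [hz, inner_sub_left, h2, smul_apply, real_inner_smul_left, sub_self]
  -- The discrepancy `z` is orthogonal to the tangent space, and also to `N`, hence tangent; so it
  -- vanishes.
  obtain ⟨w, hw⟩ := (hN.orthogonal_iff y hy z).1 (by
    rw [hz, inner_sub_right, smul_apply, smul_apply, real_inner_smul_right, real_inner_smul_right,
      hN.inner_fderiv_normal hy, hN.inner_fderiv_map hy]; ring)
  have h5 := hzperp w
  rw [hw] at h5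
  exact sub_eq_zero.1 (inner_self_eq_zero.1 h5)

end IsGraphChart

end GraphPatch

/-! ### Globalization by connectedness -/

section Global

variable {n : ℕ} {M : Type*} [TopologicalSpace M] [ChartedSpace (EuclideanSpace ℝ (Fin n)) M]
  {f : M → EuclideanSpace ℝ (Fin (n + 1))}

/-- `G` has open image and the continuous inverse "project `f`", so local statements transfer
between `Ω` and `M`. -/
theorem IsGraphChart.map_nhds {x₀ : M} {G : tangentImage f x₀ → M}
    {Ω : Set (tangentImage f x₀)} (h : IsGraphChart f x₀ G Ω) (hf : Continuous f)
    {y : tangentImage f x₀} (hy : y ∈ Ω) : Filter.map G (nhds y) = nhds (G y) := by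
  refine le_antisymm ?_ ?_
  · exact (h.smooth.continuousOn.continuousAt (h.isOpen.mem_nhds hy)).tendsto
  · have h1 : Filter.Tendsto (fun x => (tangentImage f x₀).orthogonalProjectionOnto (f x))
        (nhds (G y)) (nhds y) := by
      have h2 : Continuous fun x => (tangentImage f x₀).orthogonalProjectionOnto (f x) := by
        fun_prop
      have h3 := h2.tendsto (G y)
      rwa [h.projection y hy] at h3
    have h4 : ∀ᶠ x in nhds (G y), G ((tangentImage f x₀).orthogonalProjectionOnto (f x)) = x := by
      filter_upwards [h.isOpen_image.mem_nhds ⟨y, hy, rfl⟩]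
      rintro _ ⟨z, hz, rfl⟩
      rw [h.projection z hz]
    calc nhds (G y) = Filter.map
          (G ∘ fun x => (tangentImage f x₀).orthogonalProjectionOnto (f x)) (nhds (G y)) := by
          conv_lhs => rw [← Filter.map_id (f := nhds (G y))]
          exact Filter.map_congr (h4.mono fun x hx => hx.symm)
      _ = Filter.map G (Filter.map
          (fun x => (tangentImage f x₀).orthogonalProjectionOnto (f x)) (nhds (G y))) :=
          Filter.map_map.symm
      _ ≤ Filter.map G (nhds y) := Filter.map_mono h1

/-- A function on the hypersurface whose derivative vanishes in a graph chart is constant near the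
base point. -/
theorem IsGraphChart.eventually_eq_of_fderiv_eq_zero {E : Type*} [NormedAddCommGroup E]
    [NormedSpace ℝ E] {x₀ : M} {G : tangentImage f x₀ → M}
    {Ω : Set (tangentImage f x₀)} (h : IsGraphChart f x₀ G Ω) (hf : Continuous f) {k : M → E}
    (hk : DifferentiableOn ℝ (k ∘ G) Ω) (hd : ∀ y ∈ Ω, fderiv ℝ (k ∘ G) y = 0) :
    ∀ᶠ x in nhds x₀, k x = k x₀ := by
  obtain ⟨ε, hε, hball⟩ := Metric.mem_nhds_iff.1 (h.isOpen.mem_nhds h.mem)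
  rw [← h.apply_base, ← h.map_nhds hf h.mem, Filter.eventually_map]
  filter_upwards [Metric.ball_mem_nhds _ hε] with z hz
  rw [h.apply_base]
  have := Metric.isOpen_ball.is_const_of_fderiv_eq_zero (𝕜 := ℝ) (convex_ball _ ε).isPreconnected
    (hk.mono hball) (fun w hw => hd w (hball hw)) hz (Metric.mem_ball_self hε)
  simpa [h.apply_base] using this

variable [IsManifold (𝓡 n) ∞ M] [T2Space M]

/-- The second fundamental form of `f` is nondegenerate at some point. -/
def HasNondegeneratePoint (f : M → EuclideanSpace ℝ (Fin (n + 1))) : Prop :=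
  ∃ (x₀ : M) (G : tangentImage f x₀ → M) (Ω : Set (tangentImage f x₀))
    (N : tangentImage f x₀ → EuclideanSpace ℝ (Fin (n + 1))),
    IsGraphChart f x₀ G Ω ∧ IsOrientedPatch (f ∘ G) N Ω ∧
      ∃ y ∈ Ω, Function.Injective (fderiv ℝ N y)

theorem exists_sphere_of_hasNondegeneratePoint (hn : 2 ≤ n) [ConnectedSpace M]
    (hf : IsHypersurface f) {φ : M → ℝ}
    (hsol : IsConformalSoliton (inducedMetric f) (positionTangent f) φ)
    (hnd : HasNondegeneratePoint f) :
    ∃ (c : EuclideanSpace ℝ (Fin (n + 1))) (r : ℝ), 0 < r ∧ ∀ x : M, f x ∈ Metric.sphere c r := by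
  have hfc : Continuous f := hf.smooth.continuous
  have hfr : ∀ x : M, 2 ≤ Module.finrank ℝ (tangentImage f x) := fun x => by
    rwa [hf.finrank_tangentImage x]
  obtain ⟨x₀, G, Ω, N, hG, hN, y, hy, hinj⟩ := hnd
  obtain ⟨c, r, hr, hev⟩ := hN.exists_sphere (hfr x₀)
    (fun z hz => hG.support_smul_fderiv_normal hf hsol hN hz) hy hinj
  refine ⟨c, r, hr, ?_⟩
  set A : Set M := {x | ∀ᶠ z in nhds x, f z ∈ Metric.sphere c r} with hA
  have hAo : IsOpen A := isOpen_setOfPred_eventually_nhds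
  have hAc : IsClosed A := by
    rw [← closure_subset_iff_isClosed]
    intro x hx
    obtain ⟨G, Ω, hG⟩ := hf.exists_graphChart x
    obtain ⟨N, hN⟩ := hG.exists_orientedPatch hf
    have hfq : ∃ᶠ x' in nhds x, x' ∈ A := mem_closure_iff_frequently.1 hx
    rw [← hG.apply_base, ← hG.map_nhds hfc hG.mem, Filter.frequently_map] at hfq
    have h1 := hN.eventually_sphere_of_frequently (hfr x)
      (fun z hz => hG.support_smul_fderiv_normal hf hsol hN hz) hr hG.mem
      ((hfq.and_eventually (hG.isOpen.mem_nhds hG.mem)).mono fun z hz => by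
        have h2 : ∀ᶠ x' in nhds (G z), f x' ∈ Metric.sphere c r := hz.1
        rwa [← hG.map_nhds hfc hz.2, Filter.eventually_map] at h2)
    change ∀ᶠ z in nhds x, f z ∈ Metric.sphere c r
    rw [← hG.apply_base, ← hG.map_nhds hfc hG.mem, Filter.eventually_map]
    exact h1
  have hne : A.Nonempty := by
    refine ⟨G y, ?_⟩
    change ∀ᶠ z in nhds (G y), f z ∈ Metric.sphere c r
    rw [← hG.map_nhds hfc hy, Filter.eventually_map]
    exact hev
  have huniv := IsClopen.eq_univ ⟨hAc, hAo⟩ hne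
  intro x
  have hx : ∀ᶠ z in nhds x, f z ∈ Metric.sphere c r := (huniv ▸ Set.mem_univ x : x ∈ A)
  exact hx.self_of_nhds

/-- With `h dN = 0` everywhere, `|ξ|² = h²` is locally constant, hence constant. When it is nonzero,
`h` never vanishes, so `dN = 0` and `ξ` itself is constant; unlike `N`, it is globally defined
without an orientation. -/
theorem hyperplane_or_normalPart_eq_zero [ConnectedSpace M] (hf : IsHypersurface f) {φ : M → ℝ}
    (hsol : IsConformalSoliton (inducedMetric f) (positionTangent f) φ)
    (hnd : ¬ HasNondegeneratePoint f) :
    (∃ (a : EuclideanSpace ℝ (Fin (n + 1))) (b : ℝ), a ≠ 0 ∧ ∀ x : M, inner ℝ a (f x) = b) ∨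
      ∀ x : M, normalPart f x = 0 := by
  have hfc : Continuous f := hf.smooth.continuous
  have hdeg : ∀ {x₀ : M} {G : tangentImage f x₀ → M} {Ω : Set (tangentImage f x₀)}
      {N : tangentImage f x₀ → EuclideanSpace ℝ (Fin (n + 1))},
      IsGraphChart f x₀ G Ω → IsOrientedPatch (f ∘ G) N Ω → ∀ y ∈ Ω,
      inner ℝ ((f ∘ G) y) (N y) • fderiv ℝ N y = 0 := by
    intro x₀ G Ω N hG hN y hy
    obtain ⟨κ, hκ⟩ := hG.support_smul_fderiv_normal hf hsol hN hy
    exact hN.support_smul_fderiv_normal hy hκ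
      fun hinj => hnd ⟨x₀, G, Ω, N, hG, hN, y, hy, hinj⟩
  have hsupp : ∀ {x₀ : M} {G : tangentImage f x₀ → M} {Ω : Set (tangentImage f x₀)}
      {N : tangentImage f x₀ → EuclideanSpace ℝ (Fin (n + 1))},
      IsOrientedPatch (f ∘ G) N Ω → ∀ y ∈ Ω,
      DifferentiableAt ℝ (fun z => inner ℝ ((f ∘ G) z) (N z)) y := by
    intro x₀ G Ω N hN y hy
    simpa only [sub_zero] using hN.differentiableAt_support hy 0
  have hloc : IsLocallyConstant fun x => ‖normalPart f x‖ ^ 2 := by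
    rw [IsLocallyConstant.iff_eventually_eq]
    intro x
    obtain ⟨G, Ω, hG⟩ := hf.exists_graphChart x
    obtain ⟨N, hN⟩ := hG.exists_orientedPatch hf
    have heq : ∀ z ∈ Ω, ((fun x => ‖normalPart f x‖ ^ 2) ∘ G) z =
        (inner ℝ ((f ∘ G) z) (N z)) ^ 2 := by
      intro z hz
      simp only [Function.comp_apply (f := fun x => ‖normalPart f x‖ ^ 2)]
      rw [hG.normalPart_eq hf hN hz, norm_smul, hN.norm_normal z hz, mul_one, Real.norm_eq_abs,
        sq_abs]
    refine hG.eventually_eq_of_fderiv_eq_zero hfc ?_ fun y hy => ?_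
    · have h1 : DifferentiableOn ℝ (fun z => (inner ℝ ((f ∘ G) z) (N z)) ^ 2) Ω :=
        fun z hz => ((hsupp hN z hz).pow 2).differentiableWithinAt
      exact h1.congr heq
    · rw [Filter.EventuallyEq.fderiv_eq (Filter.eventually_of_mem (hG.isOpen.mem_nhds hy) heq)]
      exact hN.fderiv_norm_sq_support hy (hdeg hG hN y hy)
  obtain ⟨x₁⟩ := (inferInstance : Nonempty M)
  have hconst : ∀ x, ‖normalPart f x‖ ^ 2 = ‖normalPart f x₁‖ ^ 2 := fun x =>
    hloc.apply_eq_of_isPreconnected isPreconnected_univ (Set.mem_univ _) (Set.mem_univ _)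
  by_cases h0 : normalPart f x₁ = 0
  · right
    intro x
    have h1 := hconst x
    rw [h0, norm_zero] at h1
    simpa using h1
  left
  have hloc2 : IsLocallyConstant (normalPart f) := by
    rw [IsLocallyConstant.iff_eventually_eq]
    intro x
    obtain ⟨G, Ω, hG⟩ := hf.exists_graphChart x
    obtain ⟨N, hN⟩ := hG.exists_orientedPatch hf
    have heq : ∀ z ∈ Ω, (normalPart f ∘ G) z = inner ℝ ((f ∘ G) z) (N z) • N z :=
      fun z hz => hG.normalPart_eq hf hN hz
    refine hG.eventually_eq_of_fderiv_eq_zero hfc ?_ fun y hy => ?_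
    · have h1 : DifferentiableOn ℝ (fun z => inner ℝ ((f ∘ G) z) (N z) • N z) Ω :=
        fun z hz => ((hsupp hN z hz).smul (hN.differentiableAt_normal hz)).differentiableWithinAt
      exact h1.congr heq
    · rw [Filter.EventuallyEq.fderiv_eq (Filter.eventually_of_mem (hG.isOpen.mem_nhds hy) heq)]
      refine hN.fderiv_support_smul_normal hy (hdeg hG hN y hy) fun h2 => h0 ?_
      have h3 := heq y hy
      rw [h2, zero_smul] at h3
      have h4 := hconst (G y)
      rw [show normalPart f (G y) = 0 from h3, norm_zero] at h4
      simpa using h4.symm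
  refine ⟨normalPart f x₁, ‖normalPart f x₁‖ ^ 2, h0, fun x => ?_⟩
  have h1 : normalPart f x = normalPart f x₁ :=
    hloc2.apply_eq_of_isPreconnected isPreconnected_univ (Set.mem_univ _) (Set.mem_univ _)
  have h2 : f x = normalPart f x + differential f x (positionTangent f x) := by
    rw [normalPart]; abel
  rw [← h1, ← real_inner_self_eq_norm_sq]
  conv_lhs => rw [h2]
  rw [inner_add_right, inner_normalPart_differential, add_zero]

end Global

/-! ### Euler's relation and the vertex of the cone -/

section ConicGraph

variable {n : ℕ} {T : Submodule ℝ (EuclideanSpace ℝ (Fin (n + 1)))}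
  {γ : T → EuclideanSpace ℝ (Fin (n + 1))} {Ω : Set T} {ν : EuclideanSpace ℝ (Fin (n + 1))}

/-- Euler's relation integrated along a ray. -/
theorem inv_smul_comp_smul_eq {V E : Type*} [NormedAddCommGroup V] [NormedSpace ℝ V]
    [NormedAddCommGroup E] [NormedSpace ℝ E] {γ : V → E} {Ω : Set V}
    (hd : ∀ y ∈ Ω, DifferentiableAt ℝ γ y)
    (hE : ∀ y ∈ Ω, fderiv ℝ γ y y = γ y) {a b : ℝ} (ha : 0 ≤ a) {y : V}
    (hy : ∀ s ∈ Set.Ioo a b, s • y ∈ Ω) {s t : ℝ} (hs : s ∈ Set.Ioo a b)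
    (ht : t ∈ Set.Ioo a b) : s⁻¹ • γ (s • y) = t⁻¹ • γ (t • y) := by
  have key : ∀ r ∈ Set.Ioo a b, HasDerivAt (fun r : ℝ => r⁻¹ • γ (r • y)) 0 r := by
    intro r hr
    have hr0 : r ≠ 0 := (ha.trans_lt hr.1).ne'
    have h1 : HasDerivAt (fun r : ℝ => r • y) ((1 : ℝ) • y) r := (hasDerivAt_id r).smul_const y
    have h2 := (hd _ (hy r hr)).hasFDerivAt.comp_hasDerivAt r h1
    have h3 := (hasDerivAt_inv hr0).fun_smul h2
    refine h3.congr_deriv ?_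
    have h4 := hE _ (hy r hr)
    rw [map_smul] at h4
    simp only [Function.comp_apply, one_smul]
    rw [← h4, smul_smul, ← add_smul]
    have : r⁻¹ + -(r ^ 2)⁻¹ * r = 0 := by field_simp; ring
    rw [this, zero_smul]
  exact isOpen_Ioo.is_const_of_fderiv_eq_zero (𝕜 := ℝ) (f := fun r : ℝ => r⁻¹ • γ (r • y))
    isPreconnected_Ioo (fun r hr => (key r hr).differentiableAt.differentiableWithinAt)
    (fun r hr => by
      have := (key r hr).hasFDerivAt.fderiv
      rw [this]; ext; simp) hs ht

theorem eq_of_projection_eq (hνT : ∀ w, w ∈ T ↔ inner ℝ ν w = 0)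
    {z z' : EuclideanSpace ℝ (Fin (n + 1))}
    (h1 : T.orthogonalProjectionOnto z = T.orthogonalProjectionOnto z')
    (h2 : inner ℝ ν z = inner ℝ ν z') : z = z' := by
  have h3 : z - z' ∈ Tᗮ := by
    rw [← Submodule.orthogonalProjectionOnto_eq_zero_iff, map_sub, h1, sub_self]
  have h4 : z - z' ∈ T := by
    rw [hνT, inner_sub_right, h2, sub_self]
  have h5 := Submodule.inner_right_of_mem_orthogonal h4 h3
  exact sub_eq_zero.1 (inner_self_eq_zero.1 h5)

/-- The unit sphere of a hyperplane is a great hypersphere. -/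
theorem isSphericalHypersurface_inter (hν : ‖ν‖ = 1) (hνT : ∀ w, w ∈ T ↔ inner ℝ ν w = 0) :
    IsSphericalHypersurface
      {z : EuclideanSpace ℝ (Fin (n + 1)) | z ∈ T ∧ z ∈ Metric.sphere 0 1} := by
  refine ⟨fun z hz => hz.2, fun y hy => ⟨Set.univ, fun z => innerSL ℝ ν z, isOpen_univ,
    Set.mem_univ _, (innerSL ℝ ν).contDiff.contDiffOn, ?_, ν, ?_, ?_⟩⟩
  · ext z
    simp only [Set.inter_univ, Set.mem_ofPred_eq, Set.mem_univ, true_and, innerSL_apply_apply, hνT]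
    tauto
  · rw [real_inner_comm]; exact (hνT y).1 hy.1
  · have h1 : fderiv ℝ (fun z => innerSL ℝ ν z) y = innerSL ℝ ν := (innerSL ℝ ν).fderiv
    rw [h1, innerSL_apply_apply, real_inner_self_eq_norm_sq, hν]
    norm_num

/-- A hypersurface satisfying Euler's relation is flat near the vertex. -/
theorem exists_conic_of_vertex (hn : 1 ≤ n) (hT : Module.finrank ℝ T = n)
    (hν : ‖ν‖ = 1) (hνT : ∀ w, w ∈ T ↔ inner ℝ ν w = 0)
    (hΩ : IsOpen Ω) (hγ : ContDiffOn ℝ ∞ γ Ω)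
    (hP : ∀ y ∈ Ω, T.orthogonalProjectionOnto (γ y) = y) (hE : ∀ y ∈ Ω, fderiv ℝ γ y y = γ y)
    (h0 : (0 : T) ∈ Ω) (hγ0 : γ 0 = 0) (hd0 : ∀ v, fderiv ℝ γ 0 v ∈ T) :
    ∃ (B : Set T) (S O : Set (EuclideanSpace ℝ (Fin (n + 1)))), IsOpen B ∧ B ⊆ Ω ∧ 0 ∈ B ∧
      IsSphericalHypersurface S ∧ IsOpen O ∧ γ '' B = O ∩ cone S := by
  obtain ⟨ε, hε, hball⟩ := Metric.mem_nhds_iff.1 (hΩ.mem_nhds h0)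
  have hd : ∀ y ∈ Ω, DifferentiableAt ℝ γ y := fun y hy =>
    (hγ.contDiffAt (hΩ.mem_nhds hy)).differentiableAt (by simp)
  have hflat : ∀ y ∈ Metric.ball (0 : T) ε, γ y = y := by
    intro y hy
    have hyε : ‖y‖ < ε := by simpa using hy
    -- Taking `b > 1` puts the parameter `1`, that is `y` itself, inside the open interval of the
    -- ray.
    obtain ⟨b, hb1, hb⟩ : ∃ b : ℝ, 1 < b ∧ b * ‖y‖ < ε := by
      have h1 : Filter.Tendsto (fun b : ℝ => b * ‖y‖) (nhdsWithin 1 (Set.Ioi 1))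
          (nhds (1 * ‖y‖)) :=
        ((continuous_id.mul continuous_const).tendsto 1).mono_left nhdsWithin_le_nhds
      rw [one_mul] at h1
      obtain ⟨b, hb⟩ := ((h1.eventually (gt_mem_nhds hyε)).and self_mem_nhdsWithin).exists
      exact ⟨b, hb.2, hb.1⟩
    have hseg : ∀ s ∈ Set.Ioo 0 b, s • y ∈ Ω := by
      intro s hs
      apply hball
      rw [mem_ball_zero_iff, norm_smul, Real.norm_eq_abs, abs_of_pos hs.1]
      exact (mul_le_mul_of_nonneg_right hs.2.le (norm_nonneg y)).trans_lt hb
    have hconst : ∀ s ∈ Set.Ioo 0 b, s⁻¹ • γ (s • y) = γ y := by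
      intro s hs
      rw [inv_smul_comp_smul_eq hd hE le_rfl hseg hs ⟨zero_lt_one, hb1⟩]
      simp
    -- The quotient is constantly `γ y` by homogeneity, while its limit at the vertex is `dγ₀(y)`, a
    -- vector of `T`.
    have hlim : Filter.Tendsto (fun s : ℝ => s⁻¹ • γ (s • y)) (nhdsWithin 0 (Set.Ioi 0))
        (nhds (fderiv ℝ γ 0 y)) := by
      have h1 := (hd 0 h0).hasFDerivAt.hasLineDerivAt y
      have h2 := h1.tendsto_slope_zero_right
      simpa [hγ0] using h2
    have hev : (fun s : ℝ => s⁻¹ • γ (s • y)) =ᶠ[nhdsWithin 0 (Set.Ioi 0)] fun _ => γ y := by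
      filter_upwards [Ioo_mem_nhdsGT (zero_lt_one.trans hb1)] with s hs using hconst s hs
    have heq : γ y = fderiv ℝ γ 0 y :=
      tendsto_nhds_unique (tendsto_const_nhds.congr' hev.symm) hlim
    have hmem : γ y ∈ T := heq ▸ hd0 y
    have h3 := Submodule.starProjection_eq_self_iff.2 hmem
    rw [Submodule.starProjection_apply, hP y (hball hy)] at h3
    exact h3.symm
  refine ⟨Metric.ball 0 ε, {z | z ∈ T ∧ z ∈ Metric.sphere 0 1}, Metric.ball 0 ε,
    Metric.isOpen_ball, hball, Metric.mem_ball_self hε, isSphericalHypersurface_inter hν hνT,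
    Metric.isOpen_ball, ?_⟩
  have : Nontrivial T := Module.nontrivial_of_finrank_pos (R := ℝ) (by omega)
  have hunit : ∀ z ∈ T, z ≠ 0 → ‖z‖⁻¹ • z ∈ T ∧ ‖z‖⁻¹ • z ∈ Metric.sphere 0 1 := by
    intro z hz hz0
    refine ⟨T.smul_mem _ hz, ?_⟩
    rw [mem_sphere_zero_iff_norm, norm_smul, norm_inv, norm_norm,
      inv_mul_cancel₀ (norm_ne_zero_iff.2 hz0)]
  ext z
  constructor
  · rintro ⟨y, hy, rfl⟩
    rw [hflat y hy]
    refine ⟨by simpa using hy, ?_⟩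
    by_cases hy0 : (y : EuclideanSpace ℝ (Fin (n + 1))) = 0
    -- The origin belongs to the cone only because the great sphere is nonempty, which needs `n ≥
    -- 1`.
    · obtain ⟨e, he⟩ := exists_ne (0 : T)
      exact ⟨0, le_rfl, _, hunit e e.2 (by simpa using he), by rw [hy0, zero_smul]⟩
    · exact ⟨_, norm_nonneg _, _, hunit y y.2 hy0, by
        rw [smul_smul, mul_inv_cancel₀ (norm_ne_zero_iff.2 hy0), one_smul]⟩
  · rintro ⟨hz, t, ht, w, hw, rfl⟩
    have hm : t • w ∈ T := T.smul_mem t hw.1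
    have hb : (⟨t • w, hm⟩ : T) ∈ Metric.ball (0 : T) ε := by simpa using hz
    exact ⟨⟨t • w, hm⟩, hb, hflat _ hb⟩

end ConicGraph

/-! ### Cones away from the vertex -/

section ConicGraphAwayFromVertex

variable {n : ℕ} {T : Submodule ℝ (EuclideanSpace ℝ (Fin (n + 1)))}
  {γ : T → EuclideanSpace ℝ (Fin (n + 1))} {Ω : Set T} {ν : EuclideanSpace ℝ (Fin (n + 1))}

/-- The linear functional dual to `y₀`, normalised to be `1` at `y₀`. -/
def height (y₀ : T) : EuclideanSpace ℝ (Fin (n + 1)) →L[ℝ] ℝ :=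
  (‖y₀‖ ^ 2)⁻¹ • innerSL ℝ (y₀ : EuclideanSpace ℝ (Fin (n + 1)))

theorem height_self {y₀ : T} (h : y₀ ≠ 0) : height y₀ y₀ = 1 := by
  have h1 : ‖y₀‖ ^ 2 ≠ 0 := pow_ne_zero 2 (norm_ne_zero_iff.2 h)
  rw [height, smul_apply, innerSL_apply_apply, real_inner_self_eq_norm_sq,
    ← Submodule.coe_norm, smul_eq_mul, inv_mul_cancel₀ h1]

theorem height_projection (y₀ : T) (z : EuclideanSpace ℝ (Fin (n + 1))) :
    height y₀ (T.orthogonalProjectionOnto z) = height y₀ z := by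
  rw [height, smul_apply, smul_apply, innerSL_apply_apply, innerSL_apply_apply,
    ← Submodule.inner_orthogonalProjectionOnto_eq_of_mem_left y₀ z]
  rfl

theorem height_normal (hνT : ∀ w, w ∈ T ↔ inner ℝ ν w = 0) (y₀ : T) : height y₀ ν = 0 := by
  rw [height, smul_apply, innerSL_apply_apply, real_inner_comm, (hνT _).1 y₀.2, smul_zero]

theorem projection_normal (hνT : ∀ w, w ∈ T ↔ inner ℝ ν w = 0) :
    T.orthogonalProjectionOnto ν = 0 := by
  rw [Submodule.orthogonalProjectionOnto_eq_zero_iff, Submodule.mem_orthogonal']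
  exact fun w hw => (hνT w).1 hw

/-- The open solid cone of vectors whose projection to `T` has direction close to `y₀`. -/
def solidCone (y₀ : T) (ε : ℝ) : Set (EuclideanSpace ℝ (Fin (n + 1))) :=
  {z | 0 < height y₀ z ∧ ‖T.orthogonalProjectionOnto z - height y₀ z • y₀‖ < ε * height y₀ z}

theorem isOpen_solidCone (y₀ : T) (ε : ℝ) : IsOpen (solidCone y₀ ε) :=
  (isOpen_lt continuous_const (height y₀).continuous).inter
    (isOpen_lt (f := fun z => ‖T.orthogonalProjectionOnto z - height y₀ z • y₀‖)
      (by fun_prop) (continuous_const.mul (height y₀).continuous))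

theorem smul_mem_solidCone {y₀ : T} {ε t : ℝ} (ht : 0 < t) {z : EuclideanSpace ℝ (Fin (n + 1))}
    (hz : z ∈ solidCone y₀ ε) : t • z ∈ solidCone y₀ ε := by
  refine ⟨?_, ?_⟩
  · rw [map_smul]; exact mul_pos ht hz.1
  · rw [map_smul, map_smul, smul_eq_mul, mul_smul, ← smul_sub, norm_smul, Real.norm_eq_abs,
      abs_of_pos ht, mul_left_comm]
    exact mul_lt_mul_of_pos_left hz.2 ht

theorem projection_mem_solidCone_iff {y₀ : T} {ε : ℝ} {z : EuclideanSpace ℝ (Fin (n + 1))} :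
    (T.orthogonalProjectionOnto z : EuclideanSpace ℝ (Fin (n + 1))) ∈ solidCone y₀ ε ↔
      z ∈ solidCone y₀ ε := by
  simp only [solidCone, Set.mem_ofPred_eq, height_projection,
    Submodule.orthogonalProjectionOnto_mem_subspace_eq_self]

/-- The part of the solid cone at height close to `1`. -/
def truncatedCone (y₀ : T) (ε : ℝ) : Set (EuclideanSpace ℝ (Fin (n + 1))) :=
  {z | z ∈ solidCone y₀ ε ∧ height y₀ z ∈ Set.Ioo (1 - ε) (1 + ε)}

theorem isOpen_truncatedCone (y₀ : T) (ε : ℝ) : IsOpen (truncatedCone y₀ ε) :=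
  (isOpen_solidCone y₀ ε).inter (isOpen_Ioo.preimage (height y₀).continuous)

theorem projection_mem_truncatedCone_iff {y₀ : T} {ε : ℝ} {z : EuclideanSpace ℝ (Fin (n + 1))} :
    (T.orthogonalProjectionOnto z : EuclideanSpace ℝ (Fin (n + 1))) ∈ truncatedCone y₀ ε ↔
      z ∈ truncatedCone y₀ ε := by
  simp only [truncatedCone, Set.mem_ofPred_eq, projection_mem_solidCone_iff, height_projection]

theorem base_mem_truncatedCone {y₀ : T} (h : y₀ ≠ 0) {ε : ℝ} (hε : 0 < ε) :
    (y₀ : EuclideanSpace ℝ (Fin (n + 1))) ∈ truncatedCone y₀ ε := by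
  refine ⟨⟨?_, ?_⟩, ?_⟩
  · rw [height_self h]; exact one_pos
  · rw [height_self h]; simpa using hε
  · rw [height_self h]; constructor <;> linarith

theorem exists_truncatedCone_subset {y₀ : T} (hΩ : Ω ∈ nhds y₀) :
    ∃ ε : ℝ, 0 < ε ∧ ε < 1 ∧ ∀ y : T, (y : EuclideanSpace ℝ (Fin (n + 1))) ∈ truncatedCone y₀ ε →
      y ∈ Ω := by
  obtain ⟨δ, hδ, hball⟩ := Metric.mem_nhds_iff.1 hΩ
  have hpos : 0 < 2 + ‖y₀‖ := by positivity
  -- With height `l < 2`, the distance from `y` to `y₀` is less than `ε l + |l - 1| ‖y₀‖ ≤ ε (2 +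
  -- ‖y₀‖) ≤ δ`.
  refine ⟨min (1 / 2) (δ / (2 + ‖y₀‖)), lt_min (by norm_num) (by positivity),
    (min_le_left _ _).trans_lt (by norm_num), fun y hy => hball ?_⟩
  set ε := min (1 / 2) (δ / (2 + ‖y₀‖)) with hε
  have hε0 : 0 < ε := lt_min (by norm_num) (by positivity)
  have hε1 : ε ≤ 1 / 2 := min_le_left _ _
  have hε2 : ε * (2 + ‖y₀‖) ≤ δ := (le_div_iff₀ hpos).1 (min_le_right _ _)
  obtain ⟨⟨h1, h2⟩, h3, h4⟩ := hy
  rw [Submodule.orthogonalProjectionOnto_mem_subspace_eq_self] at h2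
  set l := height y₀ (y : EuclideanSpace ℝ (Fin (n + 1))) with hl
  rw [mem_ball_iff_norm]
  have h5 : ‖y - y₀‖ ≤ ‖y - l • y₀‖ + |l - 1| * ‖y₀‖ := by
    have : y - y₀ = (y - l • y₀) + (l - 1) • y₀ := by rw [sub_smul, one_smul]; abel
    rw [this]
    refine (norm_add_le _ _).trans ?_
    rw [norm_smul, Real.norm_eq_abs]
  have h6 : |l - 1| ≤ ε := abs_le.2 ⟨by linarith, by linarith⟩
  have h7 : |l - 1| * ‖y₀‖ ≤ ε * ‖y₀‖ := mul_le_mul_of_nonneg_right h6 (norm_nonneg _)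
  have h8 : ε * l ≤ ε * 2 := mul_le_mul_of_nonneg_left (by linarith) hε0.le
  linarith

theorem inv_height_smul_mem_truncatedCone {y₀ : T} {ε : ℝ} (hε : 0 < ε)
    {z : EuclideanSpace ℝ (Fin (n + 1))} (hz : z ∈ solidCone y₀ ε) :
    (height y₀ z)⁻¹ • z ∈ truncatedCone y₀ ε := by
  refine ⟨smul_mem_solidCone (inv_pos.2 hz.1) hz, ?_⟩
  rw [map_smul, smul_eq_mul, inv_mul_cancel₀ hz.1.ne']
  constructor <;> linarith

/-- The vertical defect of `z` from the cone through the graph of `γ`. -/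
def coneDefect (γ : T → EuclideanSpace ℝ (Fin (n + 1))) (y₀ : T)
    (ν z : EuclideanSpace ℝ (Fin (n + 1))) : ℝ :=
  inner ℝ ν ((height y₀ z)⁻¹ • z - γ ((height y₀ z)⁻¹ • T.orthogonalProjectionOnto z))

theorem contDiffOn_coneDefect {y₀ : T} {ε : ℝ} (hε : 0 < ε) (hγ : ContDiffOn ℝ ∞ γ Ω)
    (hsub : ∀ y : T, (y : EuclideanSpace ℝ (Fin (n + 1))) ∈ truncatedCone y₀ ε → y ∈ Ω) :
    ContDiffOn ℝ ∞ (coneDefect γ y₀ ν) (solidCone y₀ ε) := by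
  have hinv : ContDiffOn ℝ ∞ (fun z => (height y₀ z)⁻¹) (solidCone y₀ ε) :=
    (height y₀).contDiff.contDiffOn.inv fun z hz => hz.1.ne'
  have h1 : ContDiffOn ℝ ∞ (fun z => (height y₀ z)⁻¹ • T.orthogonalProjectionOnto z)
      (solidCone y₀ ε) := hinv.smul T.orthogonalProjectionOnto.contDiff.contDiffOn
  refine contDiffOn_const.inner ℝ ((hinv.smul contDiffOn_id).sub (hγ.comp h1 fun z hz => ?_))
  apply hsub
  rw [← map_smul]
  exact projection_mem_truncatedCone_iff.2 (inv_height_smul_mem_truncatedCone hε hz)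

theorem coneDefect_smul {y₀ : T} {z : EuclideanSpace ℝ (Fin (n + 1))} {t : ℝ} (ht : t ≠ 0) :
    coneDefect γ y₀ ν (t • z) = coneDefect γ y₀ ν z := by
  have h1 : (height y₀ (t • z))⁻¹ * t = (height y₀ z)⁻¹ := by
    rw [map_smul, smul_eq_mul, mul_inv, mul_right_comm, inv_mul_cancel₀ ht, one_mul]
  rw [coneDefect, coneDefect, map_smul T.orthogonalProjectionOnto, smul_smul, smul_smul, h1]

/-- Adding a multiple of `ν` changes neither height nor projection. The resulting nonzero slope
shows that the zero set of the defect is regular. -/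
theorem coneDefect_add_smul_normal (hν : ‖ν‖ = 1) (hνT : ∀ w, w ∈ T ↔ inner ℝ ν w = 0) (y₀ : T)
    (z : EuclideanSpace ℝ (Fin (n + 1))) (t : ℝ) :
    coneDefect γ y₀ ν (z + t • ν) = coneDefect γ y₀ ν z + t * (height y₀ z)⁻¹ := by
  have h1 : height y₀ (z + t • ν) = height y₀ z := by
    rw [map_add, map_smul, height_normal hνT, smul_zero, add_zero]
  have h2 : T.orthogonalProjectionOnto (z + t • ν) = T.orthogonalProjectionOnto z := by
    rw [map_add, map_smul, projection_normal hνT, smul_zero, add_zero]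
  rw [coneDefect, coneDefect, h1, h2, inner_sub_right, inner_sub_right, smul_add, inner_add_right,
    smul_smul, real_inner_smul_right ν ν, real_inner_self_eq_norm_sq, hν]
  ring

theorem coneDefect_eq_zero_iff (hνT : ∀ w, w ∈ T ↔ inner ℝ ν w = 0) {y₀ : T} {ε : ℝ} (hε : 0 < ε)
    (hsub : ∀ y : T, (y : EuclideanSpace ℝ (Fin (n + 1))) ∈ truncatedCone y₀ ε → y ∈ Ω)
    (hP : ∀ y ∈ Ω, T.orthogonalProjectionOnto (γ y) = y)
    {z : EuclideanSpace ℝ (Fin (n + 1))} (hz : z ∈ solidCone y₀ ε) :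
    coneDefect γ y₀ ν z = 0 ↔
      γ ((height y₀ z)⁻¹ • T.orthogonalProjectionOnto z) = (height y₀ z)⁻¹ • z := by
  constructor
  · intro h
    refine eq_of_projection_eq hνT ?_ ?_
    · rw [hP _ (hsub _ ?_), map_smul]
      rw [← map_smul]
      exact projection_mem_truncatedCone_iff.2 (inv_height_smul_mem_truncatedCone hε hz)
    · rw [coneDefect, inner_sub_right] at h
      linarith
  · intro h
    rw [coneDefect, h, sub_self, inner_zero_right]

/-- A hypersurface satisfying Euler's relation is a cone away from the vertex. -/
theorem exists_conic_of_ne_zero (hν : ‖ν‖ = 1) (hνT : ∀ w, w ∈ T ↔ inner ℝ ν w = 0)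
    (hΩ : IsOpen Ω) (hγ : ContDiffOn ℝ ∞ γ Ω)
    (hP : ∀ y ∈ Ω, T.orthogonalProjectionOnto (γ y) = y) (hE : ∀ y ∈ Ω, fderiv ℝ γ y y = γ y)
    {y₀ : T} (hy₀ : y₀ ∈ Ω) (h0 : y₀ ≠ 0) :
    ∃ (B : Set T) (S O : Set (EuclideanSpace ℝ (Fin (n + 1)))), IsOpen B ∧ B ⊆ Ω ∧ y₀ ∈ B ∧
      IsSphericalHypersurface S ∧ IsOpen O ∧ γ '' B = O ∩ cone S := by
  have hd : ∀ y ∈ Ω, DifferentiableAt ℝ γ y := fun y hy =>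
    (hγ.contDiffAt (hΩ.mem_nhds hy)).differentiableAt (by simp)
  obtain ⟨ε, hε, hε1, hsub⟩ := exists_truncatedCone_subset (hΩ.mem_nhds hy₀)
  have hiff := fun {z} => coneDefect_eq_zero_iff (z := z) hνT hε hsub hP
  -- Compare the parameters `1` and `l` on the ray through `l⁻¹ y`; the truncated cone contains the
  -- segment between them.
  have hhom : ∀ y : T, (y : EuclideanSpace ℝ (Fin (n + 1))) ∈ truncatedCone y₀ ε →
      γ ((height y₀ y)⁻¹ • y) = (height y₀ y)⁻¹ • γ y := by
    intro y hy
    set l := height y₀ (y : EuclideanSpace ℝ (Fin (n + 1))) with hl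
    have hl0 : l ≠ 0 := hy.1.1.ne'
    have hseg : ∀ s ∈ Set.Ioo (1 - ε) (1 + ε), s • (l⁻¹ • y) ∈ Ω := by
      intro s hs
      apply hsub
      have hs0 : 0 < s := by linarith [hs.1]
      refine ⟨smul_mem_solidCone hs0 (smul_mem_solidCone (inv_pos.2 hy.1.1) hy.1), ?_⟩
      rw [Submodule.coe_smul, Submodule.coe_smul, map_smul, map_smul, ← hl, smul_eq_mul,
        smul_eq_mul, inv_mul_cancel₀ hl0, mul_one]
      exact hs
    have h1 := inv_smul_comp_smul_eq hd hE (by linarith) hseg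
      (s := 1) (t := l) ⟨by linarith, by linarith⟩ hy.2
    rw [inv_one, one_smul, one_smul, smul_smul, mul_inv_cancel₀ hl0, one_smul] at h1
    exact h1
  set S : Set (EuclideanSpace ℝ (Fin (n + 1))) :=
    {z | z ∈ Metric.sphere 0 1 ∧ z ∈ solidCone y₀ ε ∧ coneDefect γ y₀ ν z = 0} with hS
  refine ⟨{y | (y : EuclideanSpace ℝ (Fin (n + 1))) ∈ truncatedCone y₀ ε}, S, truncatedCone y₀ ε,
    (isOpen_truncatedCone y₀ ε).preimage continuous_subtype_val, hsub,
    base_mem_truncatedCone h0 hε, ?_, isOpen_truncatedCone y₀ ε, ?_⟩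
  · refine ⟨fun z hz => hz.1, fun y hy => ⟨solidCone y₀ ε, coneDefect γ y₀ ν,
      isOpen_solidCone y₀ ε, hy.2.1, contDiffOn_coneDefect hε hγ hsub, ?_,
      -- Removing the radial part of `ν` gives a vector tangent to the sphere, and costs nothing:
      -- the defect is homogeneous of degree zero, so its radial derivative vanishes.
      ν - (inner ℝ y ν : ℝ) • y, ?_, ?_⟩⟩
    · ext z
      simp only [hS, Set.mem_inter_iff, Set.mem_ofPred_eq]
      tauto
    · rw [inner_sub_right, real_inner_smul_right, real_inner_self_eq_norm_sq,
        mem_sphere_zero_iff_norm.1 hy.1]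
      ring
    · have hdF : DifferentiableAt ℝ (coneDefect γ y₀ ν) y :=
        ((contDiffOn_coneDefect hε hγ hsub).contDiffAt
          ((isOpen_solidCone y₀ ε).mem_nhds hy.2.1)).differentiableAt (by simp)
      have h1 : fderiv ℝ (coneDefect γ y₀ ν) y y = 0 := by
        rw [← hdF.lineDeriv_eq_fderiv, lineDeriv]
        have : (fun t : ℝ => coneDefect γ y₀ ν (y + t • y)) =ᶠ[nhds 0]
            fun _ => coneDefect γ y₀ ν y := by
          filter_upwards [Ioi_mem_nhds (show (-1 : ℝ) < 0 by norm_num)] with t ht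
          have ht' : 1 + t ≠ 0 := by
            have : -1 < t := ht
            linarith
          rw [← coneDefect_smul (z := y) ht', add_smul, one_smul]
        rw [this.deriv_eq, deriv_const]
      have h2 : fderiv ℝ (coneDefect γ y₀ ν) y ν = (height y₀ y)⁻¹ := by
        rw [← hdF.lineDeriv_eq_fderiv, lineDeriv]
        simp only [coneDefect_add_smul_normal hν hνT]
        have := ((hasDerivAt_id (0 : ℝ)).mul_const (height y₀ y)⁻¹).const_add
          (coneDefect γ y₀ ν y)
        rw [one_mul] at this
        exact this.deriv
      rw [map_sub, map_smul, h1, h2, smul_zero, sub_zero]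
      exact inv_ne_zero hy.2.1.1.ne'
  · ext z
    constructor
    · rintro ⟨y, hy, rfl⟩
      have hyΩ := hsub y hy
      have hPy := hP y hyΩ
      have hmem : γ y ∈ truncatedCone y₀ ε := by
        rw [← projection_mem_truncatedCone_iff, hPy]; exact hy
      have hht : height y₀ (γ y) = height y₀ y := by rw [← height_projection, hPy]
      have hne : γ y ≠ 0 := by
        intro h
        have := hmem.1.1
        rw [h, map_zero] at this
        exact lt_irrefl _ this
      have hnorm : 0 < ‖γ y‖ := norm_pos_iff.2 hne
      refine ⟨hmem, ‖γ y‖, hnorm.le, ‖γ y‖⁻¹ • γ y, ⟨?_, ?_, ?_⟩, ?_⟩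
      · rw [mem_sphere_zero_iff_norm, norm_smul, norm_inv, norm_norm, inv_mul_cancel₀ hnorm.ne']
      · exact smul_mem_solidCone (inv_pos.2 hnorm) hmem.1
      · rw [coneDefect_smul (inv_ne_zero hnorm.ne'), hiff hmem.1, hht, hPy]
        exact hhom y hy
      · rw [smul_smul, mul_inv_cancel₀ hnorm.ne', one_smul]
    · rintro ⟨hz, t, ht, w, ⟨hw1, hw2, hw3⟩, rfl⟩
      have ht0 : t ≠ 0 := by
        rintro rfl
        have := hz.1.1
        rw [zero_smul, map_zero] at this
        exact lt_irrefl _ this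
      have hy : (T.orthogonalProjectionOnto (t • w) : EuclideanSpace ℝ (Fin (n + 1))) ∈
          truncatedCone y₀ ε := projection_mem_truncatedCone_iff.2 hz
      refine ⟨T.orthogonalProjectionOnto (t • w), hy, ?_⟩
      rw [← coneDefect_smul ht0, hiff hz.1] at hw3
      have h1 := hhom _ hy
      rw [height_projection, hw3] at h1
      exact (smul_right_injective _ (inv_ne_zero hz.1.1.ne') h1).symm

end ConicGraphAwayFromVertex

/-! ### Hypersurfaces with tangent position vector -/

section Conic

variable {n : ℕ} {M : Type*} [TopologicalSpace M] [ChartedSpace (EuclideanSpace ℝ (Fin n)) M]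
  {f : M → EuclideanSpace ℝ (Fin (n + 1))} [IsManifold (𝓡 n) ∞ M]

/-- A hypersurface whose position vector is everywhere tangent is conic. -/
theorem isConic_of_normalPart_eq_zero (hn : 1 ≤ n) (hf : IsHypersurface f)
    (h0 : ∀ x : M, normalPart f x = 0) : IsConic f := by
  have hfc : Continuous f := hf.smooth.continuous
  have hmem : ∀ x, f x ∈ tangentImage f x := fun x => by
    have h1 := h0 x
    rw [normalPart, sub_eq_zero] at h1
    rw [h1]
    exact differential_mem_tangentImage f x _
  intro x₀
  obtain ⟨ν, hν, hνT⟩ := hf.exists_unit_normal x₀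
  have hν0 : ν ≠ 0 := by
    rintro rfl
    simp at hν
  have hνT' : ∀ w, w ∈ tangentImage f x₀ ↔ inner ℝ ν w = 0 := fun w =>
    hf.mem_tangentImage_iff hν0 hνT
  obtain ⟨G, Ω, hG⟩ := hf.exists_graphChart x₀
  -- Tangency gives `γ(y) = dγ_y(v)` for some `v`; projecting to the base of the graph identifies
  -- `v` with `y`.
  have hE : ∀ y ∈ Ω, fderiv ℝ (f ∘ G) y y = (f ∘ G) y := by
    intro y hy
    obtain ⟨v, hv⟩ := (hG.exists_fderiv_eq_iff hf hy).2 (hmem (G y))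
    have h1 := hG.projection_fderiv hf hy v
    rw [hv, hG.projection y hy] at h1
    rw [← h1] at hv
    exact hv
  have hmain : ∃ (B : Set (tangentImage f x₀)) (S O : Set (EuclideanSpace ℝ (Fin (n + 1)))),
      IsOpen B ∧ B ⊆ Ω ∧ (tangentImage f x₀).orthogonalProjectionOnto (f x₀) ∈ B ∧
      IsSphericalHypersurface S ∧ IsOpen O ∧ (f ∘ G) '' B = O ∩ cone S := by
    by_cases hx : (tangentImage f x₀).orthogonalProjectionOnto (f x₀) = 0
    · have hm := hG.mem
      have hb := hG.apply_base
      rw [hx] at hm hb ⊢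
      refine exists_conic_of_vertex hn (hf.finrank_tangentImage x₀) hν hνT' hG.isOpen
        (hG.contDiffOn hf) hG.projection hE hm ?_ fun v => ?_
      · have h1 := Submodule.starProjection_eq_self_iff.2 (hmem x₀)
        rw [Submodule.starProjection_apply, hx] at h1
        rw [Function.comp_apply, hb, ← h1, Submodule.coe_zero]
      · have h1 := (hG.exists_fderiv_eq_iff hf hm).1 ⟨v, rfl⟩
        rwa [hb] at h1
    · exact exists_conic_of_ne_zero hν hνT' hG.isOpen (hG.contDiffOn hf) hG.projection hE
        hG.mem hx
  obtain ⟨B, S, O, hB, hBΩ, hxB, hS, hO, himg⟩ := hmain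
  refine ⟨G '' B, S, O, ?_, ⟨_, hxB, hG.apply_base⟩, hS, hO, ?_⟩
  · rw [isOpen_iff_mem_nhds]
    rintro _ ⟨y, hy, rfl⟩
    rw [← hG.map_nhds hfc (hBΩ hy)]
    exact Filter.image_mem_map (hB.mem_nhds hy)
  · rw [← Set.image_comp, himg]

end Conic

end ConformalSoliton

end

theorem theorem1p1 {n : ℕ} (hn : 2 ≤ n) {M : Type*} [TopologicalSpace M]
    [ChartedSpace (EuclideanSpace ℝ (Fin n)) M] [IsManifold (𝓡 n) ∞ M]
    [T2Space M] [SecondCountableTopology M] [ConnectedSpace M]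
    (f : M → EuclideanSpace ℝ (Fin (n + 1))) (hf : ConformalSoliton.IsHypersurface f)
    (φ : M → ℝ)
    (hsol : ConformalSoliton.IsConformalSoliton (ConformalSoliton.inducedMetric f)
      (ConformalSoliton.positionTangent f) φ) :
    (∃ (a : EuclideanSpace ℝ (Fin (n + 1))) (b : ℝ), a ≠ 0 ∧ ∀ x : M, inner ℝ a (f x) = b) ∨
    ConformalSoliton.IsConic f ∨
    (∃ (c : EuclideanSpace ℝ (Fin (n + 1))) (r : ℝ), 0 < r ∧
      ∀ x : M, f x ∈ Metric.sphere c r) := by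
  by_cases hnd : ConformalSoliton.HasNondegeneratePoint f
  · exact Or.inr (Or.inr
      (ConformalSoliton.exists_sphere_of_hasNondegeneratePoint hn hf hsol hnd))
  · rcases ConformalSoliton.hyperplane_or_normalPart_eq_zero hf hsol hnd with h | h
    · exact Or.inl h
    · exact Or.inr (Or.inl (ConformalSoliton.isConic_of_normalPart_eq_zero (by omega) hf h))
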